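/- Let $L/k$ be a finite Galois extension of fields with group $G=\mathrm{Gal}(L/k)$, and let $\alpha: G\times G\to L^{*}$ be a $2$-cocycle (for the Galois action of $G$ on $L^*$) all of whose values are roots of unity. Let $L^{\alpha}_tG$ be the crossed product algebra, i.e. the $k$-algebra with $L$-basis $\{U_g\}_{g\in G}$ and product $(xU_g)(yU_h)=x\,g(y)\,\alpha(g,h)\,U_{gh}$ for $x,y\in L$, $g,h\in G$. Let $\widehat G$ be the subgroup of the unit group of $L^{\alpha}_tG$ generated by the $U_g$, and let $\pi:\widehat G\to G$ be the homomorphism that sends an element of $\widehat G$ of the form $xU_g$ ($x\in L^*$) to $g$. Let $T=\mathbb Z_2G$ be the elementary abelian $2$-group with $\mathbb{Z}_2$-basis $G$, on which $\widehat G$ acts through $\pi$ and left multiplication; denote this action by $\psi$. Let $k[T]\rtimes k\widehat G$ be the Hopf algebra over $k$ with basis $e_t\otimes n$ ($t\in T$, $n\in\widehat G$), product $(e_{t}\otimes n)(e_{s}\otimes m)=\delta_{t,\psi(n)(s)}\,e_{t}\otimes nm$, coproduct $\Delta(e_t\otimes n)=\sum_{rs=t}(e_r\otimes n)\otimes(e_s\otimes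 n)$ and counit $\varepsilon(e_t\otimes n)=\delta_{t,1}$. Then there is a finite-dimensional Hopf algebra $H$ over $k$ such that (i) $H$ is a $k$-form of $L\otimes_k(k[T]\rtimes k\widehat G)$, i.e. $L\otimes_kH\cong L\otimes_k(k[T]\rtimes k\widehat G)$ as Hopf algebras over $L$; (ii) there is a surjective homomorphism of $k$-algebras $H\to L^{\alpha}_tG$; (iii) if $\mathrm{char}(k)\nmid|G|$, then $H$ is semisimple. -/

import Mathlib

open scoped TensorProduct

universe u v

noncomputable section

namespace HopfSchur

/-! ### The crossed product algebra -/

section CrossedProduct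

variable {k L : Type*} [Field k] [Field L] [Algebra k L]

/-- The crossed product algebra `L^α_t G`, `G = Gal(L/k)`, of a 2-cocycle `α : G × G → Lˣ`:
the `L`-vector space with basis `(U_g)`, where `x U_g` is `single g x`, with the product
`(x U_g) (y U_h) = x g(y) α(g,h) U_{gh}`. The cocycle is not assumed to be normalized, so that the
unit element is `α(1,1)⁻¹ U_1`. -/
def CrossedProduct (α : Gal(L/k) × Gal(L/k) → Lˣ) (_hα : groupCohomology.IsMulCocycle₂ α) :=
  Gal(L/k) →₀ L

namespace CrossedProduct

variable {α : Gal(L/k) × Gal(L/k) → Lˣ} {hα : groupCohomology.IsMulCocycle₂ α}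

instance : AddCommGroup (CrossedProduct α hα) := inferInstanceAs (AddCommGroup (Gal(L/k) →₀ L))

instance : Module k (CrossedProduct α hα) := inferInstanceAs (Module k (Gal(L/k) →₀ L))

variable (hα) in
/-- The element `x U_g`. -/
def single (g : Gal(L/k)) : L →ₗ[k] CrossedProduct α hα := Finsupp.lsingle g

@[elab_as_elim]
lemma induction_single {P : CrossedProduct α hα → Prop} (a : CrossedProduct α hα)
    (zero : P 0) (add : ∀ a b, P a → P b → P (a + b)) (single : ∀ g x, P (single hα g x)) : P a :=
  Finsupp.induction_linear a zero add single

lemma single_inj {g h : Gal(L/k)} {x y : Lˣ} (e : single hα g (x : L) = single hα h (y : L)) :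
    g = h :=
  (((Finsupp.single_eq_single_iff _ _ _ _).1 e).resolve_right fun H => x.ne_zero H.1).1

variable (α hα) in
/-- The multiplication as a `k`-bilinear map. -/
def mulMap : CrossedProduct α hα →ₗ[k] CrossedProduct α hα →ₗ[k] CrossedProduct α hα :=
  Finsupp.lsum k fun g => LinearMap.flip <| Finsupp.lsum k fun h =>
    LinearMap.mk₂ k (fun y x : L => single hα (g * h) (x * g y * α (g, h)))
      (by intro y y' x; rw [← map_add]; congr 1; simp; ring)
      (by intro c y x; rw [← map_smul]; congr 1; simp)
      (by intro y x x'; rw [← map_add]; congr 1; ring)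
      (by intro c y x; rw [← map_smul]; congr 1; simp)

instance : Mul (CrossedProduct α hα) := ⟨fun a b => mulMap α hα a b⟩

instance : One (CrossedProduct α hα) := ⟨single hα 1 ((α (1, 1))⁻¹ : Lˣ)⟩

lemma mulMap_apply (a b : CrossedProduct α hα) : mulMap α hα a b = a * b := rfl

lemma one_def : (1 : CrossedProduct α hα) = single hα 1 ((α (1, 1))⁻¹ : Lˣ) := rfl

lemma single_mul_single (g h : Gal(L/k)) (x y : L) :
    single hα g x * single hα h y = single hα (g * h) (x * g y * α (g, h)) := by
  change mulMap α hα (Finsupp.single g x) (Finsupp.single h y) = _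
  unfold mulMap
  erw [Finsupp.lsum_single, LinearMap.flip_apply, Finsupp.lsum_single]
  rfl

lemma cocycle (hα : groupCohomology.IsMulCocycle₂ α) (g h j : Gal(L/k)) :
    (α (g * h, j) * α (g, h) : L) = g (α (h, j)) * α (g, h * j) :=
  congrArg Units.val (hα g h j)

instance : NonUnitalNonAssocRing (CrossedProduct α hα) where
  __ := (inferInstance : AddCommGroup (CrossedProduct α hα))
  left_distrib a b c := by simp [← mulMap_apply]
  right_distrib a b c := by simp [← mulMap_apply]
  zero_mul a := by simp [← mulMap_apply]
  mul_zero a := by simp [← mulMap_apply]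

instance : Ring (CrossedProduct α hα) where
  __ := (inferInstance : NonUnitalNonAssocRing (CrossedProduct α hα))
  mul_assoc a b c := by
    induction a using induction_single with
    | zero => simp
    | add a a' h h' => simp only [add_mul, h, h']
    | single g x =>
    induction b using induction_single with
    | zero => simp
    | add b b' h h' => simp only [add_mul, mul_add, h, h']
    | single h y =>
    induction c using induction_single with
    | zero => simp
    | add c c' h h' => simp only [mul_add, h, h']
    | single j z =>
      simp only [single_mul_single, mul_assoc g h j]
      congr 1
      simp only [map_mul, AlgEquiv.mul_apply]
      linear_combination x * g y * g (h z) * cocycle hα g h j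
  one_mul a := by
    induction a using induction_single with
    | zero => simp
    | add a a' h h' => simp only [mul_add, h, h']
    | single g x =>
      have := groupCohomology.map_one_fst_of_isMulCocycle₂ hα g
      rw [one_def, single_mul_single, one_mul, this]
      congr 1
      rw [mul_right_comm, Units.inv_mul, one_mul, AlgEquiv.one_apply]
  mul_one a := by
    induction a using induction_single with
    | zero => simp
    | add a a' h h' => simp only [add_mul, h, h']
    | single g x =>
      have := congrArg Units.val (groupCohomology.map_one_snd_of_isMulCocycle₂ hα g)
      rw [one_def, single_mul_single, mul_one, this]
      congr 1
      simp [AlgEquiv.smul_units_def]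

instance : Algebra k (CrossedProduct α hα) :=
  Algebra.ofModule (fun r a b => by simp [← mulMap_apply]) (fun r a b => by simp [← mulMap_apply])

/-- The unit `x U_g`, `x ∈ Lˣ`, of the crossed product algebra. -/
def unitSingle (hα : groupCohomology.IsMulCocycle₂ α) (g : Gal(L/k)) (x : Lˣ) :
    (CrossedProduct α hα)ˣ where
  val := single hα g x
  inv := single hα g⁻¹ ((g⁻¹ • x)⁻¹ * (α (g⁻¹, g))⁻¹ * (α (1, 1))⁻¹ : Lˣ)
  val_inv := by
    have h1 := groupCohomology.smul_map_inv_div_map_inv_of_isMulCocycle₂ hα g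
    rw [groupCohomology.map_one_snd_of_isMulCocycle₂ hα g, div_eq_div_iff_mul_eq_mul] at h1
    rw [single_mul_single, one_def, mul_inv_cancel]
    refine congrArg (single hα 1) ?_
    have h2 : x * g • ((g⁻¹ • x)⁻¹ * (α (g⁻¹, g))⁻¹ * (α (1, 1))⁻¹) * α (g, g⁻¹) =
        (α (1, 1))⁻¹ := by
      rw [smul_mul', smul_mul', smul_inv', smul_inv', smul_inv', smul_inv_smul,
        ← mul_assoc, mul_inv_cancel_left, ← mul_inv, h1, mul_inv, inv_mul_cancel_right]
    exact congrArg Units.val h2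
  inv_val := by
    rw [single_mul_single, one_def, inv_mul_cancel]
    congr 1
    simp [AlgEquiv.smul_units_def]
    field_simp

variable (α hα) in
/-- The group `Ĝ`: the subgroup of the unit group of `L^α_t G` that is generated by the `U_g`. -/
def Ghat : Subgroup (CrossedProduct α hα)ˣ :=
  Subgroup.closure (Set.range fun g => unitSingle hα g 1)

lemma exists_of_mem_Ghat {u : (CrossedProduct α hα)ˣ} (hu : u ∈ Ghat α hα) :
    ∃ g : Gal(L/k), ∃ x : Lˣ, (u : CrossedProduct α hα) = single hα g (x : L) := by
  induction hu using Subgroup.closure_induction with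
  | mem u hu => obtain ⟨g, rfl⟩ := hu; exact ⟨g, 1, rfl⟩
  | one => exact ⟨1, _, one_def⟩
  | mul u v _ _ hu hv =>
    obtain ⟨g, x, hu⟩ := hu
    obtain ⟨h, y, hv⟩ := hv
    exact ⟨g * h, x * g • y * α (g, h), by rw [Units.val_mul, hu, hv, single_mul_single]; rfl⟩
  | inv u _ hu =>
    obtain ⟨g, x, hu⟩ := hu
    obtain rfl : u = unitSingle hα g x := Units.ext hu
    exact ⟨_, _, rfl⟩

variable (α hα) in
/-- The projection `Ĝ → G`, which sends an element `x U_g` of `Ĝ` to `g`. -/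
def proj : Ghat α hα →* Gal(L/k) :=
  MonoidHom.mk' (fun u => (exists_of_mem_Ghat u.2).choose) fun u v => by
    obtain ⟨x, hx⟩ := (exists_of_mem_Ghat u.2).choose_spec
    obtain ⟨y, hy⟩ := (exists_of_mem_Ghat v.2).choose_spec
    obtain ⟨z, hz⟩ := (exists_of_mem_Ghat (u * v).2).choose_spec
    have h : ((u * v : Ghat α hα) : (CrossedProduct α hα)ˣ).val = _ * _ := rfl
    rw [hx, hy, single_mul_single] at h
    exact (single_inj (hα := hα) (x := x * (exists_of_mem_Ghat u.2).choose • y * α (_, _))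
      (y := z) (h.symm.trans hz)).symm

lemma exists_eq_single_proj (u : Ghat α hα) :
    ∃ x : Lˣ, ((u : (CrossedProduct α hα)ˣ) : CrossedProduct α hα) =
      single hα (proj α hα u) (x : L) :=
  (exists_of_mem_Ghat u.2).choose_spec

end CrossedProduct

end CrossedProduct

/-! ### The semidirect product of a function algebra and a group algebra -/

section Semidirect

variable (k : Type*) [CommRing k] {T N : Type*} [Group T] [Group N]

/-- The semidirect product `k[T] ⋊ kN` of the function algebra `k[T]` of a finite group `T` and the
group algebra `kN`, for an action `ψ` of the group `N` on `T` by automorphisms. The basis vector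
`e_t ⊗ n` is `basis k ψ (t, n)`; here `e_t` is the indicator function of `t`. -/
def SemidirectHopf (_ψ : N →* MulAut T) := (T × N) →₀ k

namespace SemidirectHopf

variable {ψ : N →* MulAut T}

instance : AddCommGroup (SemidirectHopf k ψ) := inferInstanceAs (AddCommGroup ((T × N) →₀ k))

instance : Module k (SemidirectHopf k ψ) := inferInstanceAs (Module k ((T × N) →₀ k))

variable (ψ) in
/-- The basis `(e_t ⊗ n)` of `k[T] ⋊ kN`. -/
def basis : Module.Basis (T × N) k (SemidirectHopf k ψ) := ⟨LinearEquiv.refl k _⟩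

variable (ψ) in
open Classical in
/-- The product, `(e_t ⊗ n) (e_s ⊗ m) = δ_{t, ψ(n)(s)} e_t ⊗ n m`, as a bilinear map. -/
def mulMap : SemidirectHopf k ψ →ₗ[k] SemidirectHopf k ψ →ₗ[k] SemidirectHopf k ψ :=
  (basis k ψ).constr k fun p => (basis k ψ).constr k fun q =>
    if p.1 = ψ p.2 q.1 then basis k ψ (p.1, p.2 * q.2) else 0

instance : Mul (SemidirectHopf k ψ) := ⟨fun a b => mulMap k ψ a b⟩

variable {k}

lemma mulMap_apply (a b : SemidirectHopf k ψ) : mulMap k ψ a b = a * b := rfl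

open Classical in
lemma basis_mul_basis (p q : T × N) : basis k ψ p * basis k ψ q =
    if p.1 = ψ p.2 q.1 then basis k ψ (p.1, p.2 * q.2) else 0 := by
  rw [← mulMap_apply, mulMap, Module.Basis.constr_basis, Module.Basis.constr_basis]

@[elab_as_elim]
lemma induction_basis {P : SemidirectHopf k ψ → Prop} (a : SemidirectHopf k ψ)
    (zero : P 0) (add : ∀ a b, P a → P b → P (a + b))
    (smul : ∀ (c : k) a, P a → P (c • a)) (basis : ∀ p, P (basis k ψ p)) : P a :=
  Submodule.span_induction (p := fun a _ => P a) (by rintro _ ⟨p, rfl⟩; exact basis p) zero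
    (fun a b _ _ => add a b) (fun c a _ => smul c a)
    ((SemidirectHopf.basis k ψ).mem_span a)

variable [Fintype T]

/-- The unit element `∑ t, e_t ⊗ 1`. -/
instance : One (SemidirectHopf k ψ) := ⟨∑ t : T, basis k ψ (t, 1)⟩

lemma one_def : (1 : SemidirectHopf k ψ) = ∑ t : T, basis k ψ (t, 1) := rfl

instance : NonUnitalNonAssocRing (SemidirectHopf k ψ) where
  __ := (inferInstance : AddCommGroup (SemidirectHopf k ψ))
  left_distrib a b c := by simp [← mulMap_apply]
  right_distrib a b c := by simp [← mulMap_apply]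
  zero_mul a := by simp [← mulMap_apply]
  mul_zero a := by simp [← mulMap_apply]

instance : IsScalarTower k (SemidirectHopf k ψ) (SemidirectHopf k ψ) :=
  ⟨fun r a b => by simp [← mulMap_apply]⟩

instance : SMulCommClass k (SemidirectHopf k ψ) (SemidirectHopf k ψ) :=
  ⟨fun r a b => by simp [← mulMap_apply]⟩

instance : Ring (SemidirectHopf k ψ) where
  __ := (inferInstance : NonUnitalNonAssocRing (SemidirectHopf k ψ))
  mul_assoc a b c := by
    classical
    induction a using induction_basis with
    | zero => simp
    | add a a' h h' => simp only [add_mul, h, h']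
    | smul r a h => simp only [smul_mul_assoc, h]
    | basis p =>
    induction b using induction_basis with
    | zero => simp
    | add b b' h h' => simp only [add_mul, mul_add, h, h']
    | smul r a h => simp only [smul_mul_assoc, mul_smul_comm, h]
    | basis q =>
    induction c using induction_basis with
    | zero => simp
    | add c c' h h' => simp only [mul_add, h, h']
    | smul r a h => simp only [mul_smul_comm, h]
    | basis s =>
      rw [basis_mul_basis, basis_mul_basis]
      by_cases h1 : p.1 = ψ p.2 q.1 <;> by_cases h2 : q.1 = ψ q.2 s.1 <;>
        simp_all [basis_mul_basis, mul_assoc]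
  one_mul a := by
    classical
    induction a using induction_basis with
    | zero => simp
    | add a a' h h' => simp only [mul_add, h, h']
    | smul r a h => simp only [mul_smul_comm, h]
    | basis p => simp [one_def, Finset.sum_mul, basis_mul_basis]
  mul_one a := by
    classical
    induction a using induction_basis with
    | zero => simp
    | add a a' h h' => simp only [add_mul, h, h']
    | smul r a h => simp only [smul_mul_assoc, h]
    | basis p => 
      simp [one_def, Finset.mul_sum, basis_mul_basis, ← MulEquiv.symm_apply_eq]

instance : Algebra k (SemidirectHopf k ψ) := Algebra.ofModule smul_mul_assoc mul_smul_comm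

open Classical in
/-- The tensor product coalgebra structure:
`Δ(e_t ⊗ n) = ∑_{r s = t} (e_r ⊗ n) ⊗ (e_s ⊗ n)` and `ε(e_t ⊗ n) = δ_{t, 1}`. -/
instance : CoalgebraStruct k (SemidirectHopf k ψ) where
  comul := (basis k ψ).constr k fun p =>
    ∑ r : T, basis k ψ (r, p.2) ⊗ₜ[k] basis k ψ (r⁻¹ * p.1, p.2)
  counit := (basis k ψ).constr k fun p => if p.1 = 1 then 1 else 0

lemma comul_basis (p : T × N) : Coalgebra.comul (R := k) (basis k ψ p) =
    ∑ r : T, basis k ψ (r, p.2) ⊗ₜ[k] basis k ψ (r⁻¹ * p.1, p.2) :=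
  (basis k ψ).constr_basis ..

open Classical in
lemma counit_basis (p : T × N) :
    Coalgebra.counit (R := k) (basis k ψ p) = if p.1 = 1 then 1 else 0 :=
  (basis k ψ).constr_basis ..

instance : Coalgebra k (SemidirectHopf k ψ) where
  coassoc := by
    refine (basis k ψ).ext fun p => ?_
    simp only [LinearMap.comp_apply, comul_basis, map_sum, LinearMap.rTensor_tmul,
      LinearMap.lTensor_tmul, TensorProduct.sum_tmul, TensorProduct.tmul_sum,
      LinearEquiv.coe_coe, TensorProduct.assoc_tmul]
    rw [Finset.sum_comm]
    refine Finset.sum_congr rfl fun r _ => ?_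
    refine Fintype.sum_equiv (Equiv.mulLeft r⁻¹) _ _ fun s => ?_
    simp [mul_assoc]
  rTensor_counit_comp_comul := by
    refine (basis k ψ).ext fun p => ?_
    simp only [LinearMap.comp_apply, comul_basis, map_sum, LinearMap.rTensor_tmul, counit_basis,
      TensorProduct.mk_apply]
    rw [Fintype.sum_eq_single 1]
    · simp
    · intro r hr
      simp [hr]
  lTensor_counit_comp_comul := by
    refine (basis k ψ).ext fun p => ?_
    simp only [LinearMap.comp_apply, comul_basis, map_sum, LinearMap.lTensor_tmul, counit_basis,
      LinearMap.flip_apply, TensorProduct.mk_apply]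
    rw [Fintype.sum_eq_single p.1]
    · simp
    · intro r hr
      simp [inv_mul_eq_one, hr]

lemma counit_mul' (a b : SemidirectHopf k ψ) : Coalgebra.counit (R := k) (a * b) =
    Coalgebra.counit (R := k) a * Coalgebra.counit (R := k) b := by
  classical
  induction a using induction_basis with
  | zero => simp
  | add a a' h h' => simp only [add_mul, map_add, h, h']
  | smul r a h => simp only [smul_mul_assoc, map_smul, h]
  | basis p =>
  induction b using induction_basis with
  | zero => simp
  | add b b' h h' => simp only [mul_add, map_add, h, h']
  | smul r a h => simp only [mul_smul_comm, map_smul, h]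
  | basis q =>
    rw [basis_mul_basis, counit_basis, counit_basis, apply_ite (Coalgebra.counit (R := k)),
      counit_basis, map_zero]
    by_cases h1 : p.1 = 1 <;> by_cases h2 : q.1 = 1 <;> simp [h1, h2, eq_comm (a := (1 : T))]

lemma comul_mul' (a b : SemidirectHopf k ψ) : Coalgebra.comul (R := k) (a * b) =
    Coalgebra.comul (R := k) a * Coalgebra.comul (R := k) b := by
  classical
  induction a using induction_basis with
  | zero => simp
  | add a a' h h' => simp only [add_mul, map_add, h, h']
  | smul r a h => simp only [smul_mul_assoc, map_smul, h]
  | basis p =>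
  induction b using induction_basis with
  | zero => simp
  | add b b' h h' => simp only [mul_add, map_add, h, h']
  | smul r a h => simp only [mul_smul_comm, map_smul, h]
  | basis q =>
    rw [basis_mul_basis, comul_basis, comul_basis, Finset.sum_mul_sum,
      apply_ite (Coalgebra.comul (R := k)), comul_basis, map_zero]
    simp only [Algebra.TensorProduct.tmul_mul_tmul, basis_mul_basis]
    have key (i : T) : ∑ j : T, (if i = ψ p.2 j then basis k ψ (i, p.2 * q.2) else 0) ⊗ₜ[k]
        (if i⁻¹ * p.1 = ψ p.2 (j⁻¹ * q.1) then basis k ψ (i⁻¹ * p.1, p.2 * q.2) else 0) =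
        if p.1 = ψ p.2 q.1 then
          basis k ψ (i, p.2 * q.2) ⊗ₜ[k] basis k ψ (i⁻¹ * p.1, p.2 * q.2) else 0 := by
      rw [Fintype.sum_eq_single ((ψ p.2).symm i)]
      · simp [TensorProduct.tmul_ite]
      · intro j hj
        rw [if_neg, TensorProduct.zero_tmul]
        rintro rfl
        simp at hj
    simp only [key]
    split_ifs <;> simp

instance : Bialgebra k (SemidirectHopf k ψ) :=
  Bialgebra.mk' k _
    (by classical simp [one_def, counit_basis])
    (counit_mul' _ _)
    (by
      simp only [one_def, map_sum, comul_basis, Algebra.TensorProduct.one_def,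
        TensorProduct.sum_tmul, TensorProduct.tmul_sum]
      rw [Finset.sum_comm]
      nth_rw 2 [Finset.sum_comm]
      exact Finset.sum_congr rfl fun r _ =>
        Fintype.sum_equiv (Equiv.mulLeft r⁻¹) _ _ fun s => by simp)
    (comul_mul' _ _)

/-- The antipode, `S(e_t ⊗ n) = (1 ⊗ n⁻¹) (e_{t⁻¹} ⊗ 1) = e_{ψ(n⁻¹)(t⁻¹)} ⊗ n⁻¹`. -/
instance : HopfAlgebraStruct k (SemidirectHopf k ψ) where
  antipode := (basis k ψ).constr k fun p => basis k ψ (ψ p.2⁻¹ p.1⁻¹, p.2⁻¹)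

lemma antipode_basis (p : T × N) : HopfAlgebra.antipode k (basis k ψ p) =
    basis k ψ (ψ p.2⁻¹ p.1⁻¹, p.2⁻¹) :=
  (basis k ψ).constr_basis ..

instance : HopfAlgebra k (SemidirectHopf k ψ) where
  mul_antipode_rTensor_comul := by
    classical
    refine (basis k ψ).ext fun p => ?_
    simp only [LinearMap.comp_apply, comul_basis, map_sum, LinearMap.rTensor_tmul,
      LinearMap.mul'_apply, antipode_basis, basis_mul_basis, counit_basis]
    by_cases h : p.1 = 1
    · rw [if_pos h, Algebra.linearMap_apply, map_one, one_def]
      simp only [h, mul_one, if_true, inv_mul_cancel]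
      exact Fintype.sum_equiv ((Equiv.inv T).trans (ψ p.2⁻¹).toEquiv) _ _ fun r => rfl
    · simp [h]
  mul_antipode_lTensor_comul := by
    classical
    refine (basis k ψ).ext fun p => ?_
    simp only [LinearMap.comp_apply, comul_basis, map_sum, LinearMap.lTensor_tmul,
      LinearMap.mul'_apply, antipode_basis, basis_mul_basis, counit_basis]
    by_cases h : p.1 = 1
    · simp [h, one_def]
    · simp [h]

end SemidirectHopf

end Semidirect

/-! ### The group `ℤ₂G` -/

section Z2Group

/-- The group `ℤ₂G` for a finite group `G`, written multiplicatively: the vector space over `ℤ/2`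
with basis `G`. -/
def Z2Group (G : Type*) := Multiplicative (G → ZMod 2)

variable {G : Type*}

instance : CommGroup (Z2Group G) := inferInstanceAs (CommGroup (Multiplicative (G → ZMod 2)))

instance [Finite G] : Finite (Z2Group G) := inferInstanceAs (Finite (G → ZMod 2))

instance [Finite G] : Fintype (Z2Group G) := Fintype.ofFinite _

variable [Group G]

/-- The action of `G` on `ℤ₂G` by left multiplication, which sends a basis vector `h` to `g h`. -/
def leftMul : G →* MulAut (Z2Group G) where
  toFun g :=
    { toFun t := Multiplicative.ofAdd fun h => Multiplicative.toAdd t (g⁻¹ * h)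
      invFun t := Multiplicative.ofAdd fun h => Multiplicative.toAdd t (g * h)
      left_inv t := by simp; rfl
      right_inv t := by simp; rfl
      map_mul' s t := rfl }
  map_one' := by ext t; simp; rfl
  map_mul' g g' := by ext t; simp [mul_assoc]; rfl

end Z2Group

/-- The Hopf algebra `k[T] ⋊ kĜ` for `T = ℤ₂G`, on which `Ĝ` acts through `Ĝ → G` and left
multiplication. -/
abbrev SplitHopf {k L : Type*} [Field k] [Field L] [Algebra k L]
    (α : Gal(L/k) × Gal(L/k) → Lˣ) (hα : groupCohomology.IsMulCocycle₂ α) :=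
  SemidirectHopf k ((leftMul (G := Gal(L/k))).comp (CrossedProduct.proj α hα))

end HopfSchur

end

/-!
Let `T = ℤ₂G`. Right multiplication of `G` on `T` commutes with the action `ψ` of `Ĝ`, so `G` acts
semilinearly on `L ⊗[k] (k[T] ⋊ kĜ)` by `g (l e_t ⊗ n) = g l e_{t g⁻¹} ⊗ n`, and by Galois descent
the invariants form a Hopf algebra `H` over `k` with `L ⊗[k] H = L ⊗[k] (k[T] ⋊ kĜ)`.

The map `l e_t ⊗ n ↦ δ_{t, 1} l n` to the crossed product algebra, with `1 ∈ G` as a basis vector of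
`T`, is not multiplicative on `L ⊗[k] (k[T] ⋊ kĜ)`: the group `Ĝ` moves `1` and acts on `L` through
`π`. Both defects cancel on `H`, since `π n · 1 · (π n)⁻¹ = 1`. As right multiplication moves `1`
freely, the trace of `l e_1 ⊗ n` is sent to `l n`, so that `H` maps onto the crossed product.

Finally `H` is generated by its functions on `T`, which form a reduced commutative
finite-dimensional algebra, and by `Ĝ`, which normalizes them. Averaging over `Ĝ` as in Maschke's
theorem shows that `H` is semisimple: the order of `Ĝ` is invertible in `k`, because `ker π` is a
finite subgroup of `Lˣ`.
-/

noncomputable section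

namespace HopfSchur

/-! ### Tensor products along a change of base ring -/

section TensorRestrict

variable {k L M N P Q R : Type*} [CommRing k] [CommRing L] [Algebra k L]
  [AddCommGroup M] [Module k M] [AddCommGroup N] [Module k N] [AddCommGroup R] [Module k R]
  [AddCommGroup P] [Module k P] [Module L P] [IsScalarTower k L P]
  [AddCommGroup Q] [Module k Q] [Module L Q] [IsScalarTower k L Q]

variable (L) in
/-- The `k`-linear map `M ⊗[k] N → P ⊗[L] Q` induced by `k`-linear maps `M → P` and `N → Q` into
`L`-modules. -/
def tensorRestrict (i : M →ₗ[k] P) (j : N →ₗ[k] Q) : M ⊗[k] N →ₗ[k] P ⊗[L] Q :=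
  TensorProduct.mapOfCompatibleSMul L k k P Q ∘ₗ TensorProduct.map i j

@[simp]
lemma tensorRestrict_tmul (i : M →ₗ[k] P) (j : N →ₗ[k] Q) (m : M) (n : N) :
    tensorRestrict L i j (m ⊗ₜ n) = i m ⊗ₜ j n := rfl

lemma tensorRestrict_rTensor {M' P' : Type*} [AddCommGroup M'] [Module k M'] [AddCommGroup P']
    [Module k P'] [Module L P'] [IsScalarTower k L P'] {i : M →ₗ[k] P} {i' : M' →ₗ[k] P'}
    {f : M →ₗ[k] M'} {f' : P →ₗ[L] P'} (hf : ∀ m, i' (f m) = f' (i m)) (j : N →ₗ[k] Q)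
    (w : M ⊗[k] N) :
    tensorRestrict L i' j (f.rTensor N w) = f'.rTensor Q (tensorRestrict L i j w) := by
  induction w with
  | zero => simp
  | add v w hv hw => simp only [map_add, hv, hw]
  | tmul m n => simp [hf]

lemma tensorRestrict_lTensor {N' Q' : Type*} [AddCommGroup N'] [Module k N'] [AddCommGroup Q']
    [Module k Q'] [Module L Q'] [IsScalarTower k L Q'] {j : N →ₗ[k] Q} {j' : N' →ₗ[k] Q'}
    {g : N →ₗ[k] N'} {g' : Q →ₗ[L] Q'} (hg : ∀ n, j' (g n) = g' (j n)) (i : M →ₗ[k] P)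
    (w : M ⊗[k] N) :
    tensorRestrict L i j' (g.lTensor M w) = g'.lTensor P (tensorRestrict L i j w) := by
  induction w with
  | zero => simp
  | add v w hv hw => simp only [map_add, hv, hw]
  | tmul m n => simp [hg]

lemma tensorRestrict_assoc {S : Type*} [AddCommGroup S] [Module k S] [Module L S]
    [IsScalarTower k L S] (h : M →ₗ[k] P) (i : N →ₗ[k] Q) (j : R →ₗ[k] S)
    (w : M ⊗[k] N ⊗[k] R) :
    tensorRestrict L h (tensorRestrict L i j) (TensorProduct.assoc k M N R w) =
      TensorProduct.assoc L P Q S (tensorRestrict L (tensorRestrict L h i) j w) := by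
  suffices tensorRestrict L h (tensorRestrict L i j) ∘ₗ (TensorProduct.assoc k M N R).toLinearMap =
      (TensorProduct.assoc L P Q S).toLinearMap.restrictScalars k ∘ₗ
        tensorRestrict L (tensorRestrict L h i) j from LinearMap.congr_fun this w
  ext m n r
  rfl

lemma lid_tensorRestrict (i : M →ₗ[k] P) (w : k ⊗[k] M) :
    TensorProduct.lid L P (tensorRestrict L (Algebra.linearMap k L) i w) =
      i (TensorProduct.lid k M w) := by
  induction w with
  | zero => simp
  | add v w hv hw => simp only [map_add, hv, hw]
  | tmul c m => simp

lemma rid_tensorRestrict (i : M →ₗ[k] P) (w : M ⊗[k] k) :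
    TensorProduct.rid L P (tensorRestrict L i (Algebra.linearMap k L) w) =
      i (TensorProduct.rid k M w) := by
  induction w with
  | zero => simp
  | add v w hv hw => simp only [map_add, hv, hw]
  | tmul m c => simp

lemma map_liftBaseChange_tensorTensorTensorComm (i : M →ₗ[k] P) (j : N →ₗ[k] Q) (w : M ⊗[k] N) :
    TensorProduct.map (i.liftBaseChange L) (j.liftBaseChange L)
      (TensorProduct.AlgebraTensorModule.tensorTensorTensorComm k L k L L L M N
        (((1 : L) ⊗ₜ[L] (1 : L)) ⊗ₜ[k] w)) = tensorRestrict L i j w := by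
  induction w with
  | zero => simp
  | add v w hv hw => simp only [TensorProduct.tmul_add, map_add, hv, hw]
  | tmul m n => simp

section Algebra

variable {A B : Type*} [Ring A] [Algebra k A] [Ring B] [Algebra k B] [Algebra L B]
  [IsScalarTower k L B]

lemma mul'_tensorRestrict (i : A →ₐ[k] B) (w : A ⊗[k] A) :
    LinearMap.mul' L B (tensorRestrict L i.toLinearMap i.toLinearMap w) =
      i (LinearMap.mul' k A w) := by
  induction w with
  | zero => simp
  | add v w hv hw => simp only [map_add, hv, hw]
  | tmul a b => simp

lemma tensorRestrict_mul (i : A →ₐ[k] B) (v w : A ⊗[k] A) :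
    tensorRestrict L i.toLinearMap i.toLinearMap (v * w) =
      tensorRestrict L i.toLinearMap i.toLinearMap v *
        tensorRestrict L i.toLinearMap i.toLinearMap w := by
  induction v with
  | zero => simp
  | add v v' hv hv' => simp only [add_mul, map_add, hv, hv']
  | tmul a b =>
  induction w with
  | zero => simp
  | add w w' hw hw' => simp only [mul_add, map_add, hw, hw']
  | tmul c d => simp

end Algebra

lemma isBaseChange_tensorRestrict {i : M →ₗ[k] P} {j : N →ₗ[k] Q} (hi : IsBaseChange L i)
    (hj : IsBaseChange L j) : IsBaseChange L (tensorRestrict L i j) :=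
  .of_equiv (TensorProduct.AlgebraTensorModule.distribBaseChange k L M N ≪≫ₗ
    TensorProduct.congr hi.equiv hj.equiv) fun w => by
      induction w with
      | zero => simp
      | add v w hv hw => rw [TensorProduct.tmul_add, map_add, map_add, hv, hw]
      | tmul m n => simp [IsBaseChange.equiv_tmul]

lemma span_range_eq_top_of_isBaseChange {i : M →ₗ[k] P} (hi : IsBaseChange L i) :
    Submodule.span L (LinearMap.range i : Set P) = ⊤ := by
  refine Submodule.eq_top_iff'.2 fun p => ?_
  induction p using hi.inductionOn with
  | zero => exact zero_mem _
  | add p q hp hq => exact add_mem hp hq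
  | smul l p hp => exact Submodule.smul_mem _ l hp
  | tmul m => exact Submodule.subset_span ⟨m, rfl⟩

lemma injective_of_isBaseChange [Module.FaithfullyFlat k L] {i : M →ₗ[k] P}
    (hi : IsBaseChange L i) : Function.Injective i := by
  have h : i = hi.equiv ∘ TensorProduct.mk k L M 1 := by
    ext m
    simp [IsBaseChange.equiv_tmul]
  rw [h]
  exact hi.equiv.injective.comp (Module.FaithfullyFlat.tensorProduct_mk_injective M)

variable (k L) in
lemma injective_linearMap_of_faithfullyFlat [Module.FaithfullyFlat k L] :
    Function.Injective (Algebra.linearMap k L) :=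
  injective_of_isBaseChange (IsBaseChange.linearMap k L)

end TensorRestrict

/-! ### Forms of Hopf algebras -/

section HopfForm

variable {k B : Type*} (L : Type*) [CommRing k] [CommRing L] [Algebra k L] [Ring B]
  [HopfAlgebra L B] [Algebra k B] [IsScalarTower k L B]

/-- A `k`-form of a Hopf algebra `B` over `L`: a `k`-subalgebra `H` with `L ⊗[k] H = B` to which
the comultiplication, the counit and the antipode of `B` restrict. -/
structure IsHopfForm (H : Subalgebra k B) : Prop where
  isBaseChange : IsBaseChange L H.val.toLinearMap
  comul_mem (x : H) : Coalgebra.comul (R := L) (x : B) ∈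
    LinearMap.range (tensorRestrict L H.val.toLinearMap H.val.toLinearMap)
  counit_mem (x : H) :
    Coalgebra.counit (R := L) (x : B) ∈ LinearMap.range (Algebra.linearMap k L)
  antipode_mem (x : H) : HopfAlgebra.antipode L (x : B) ∈ H

namespace IsHopfForm

variable {L} {H : Subalgebra k B} (hH : IsHopfForm L H)
include hH

/-- The isomorphism `L ⊗[k] H ≃ B` of algebras over `L`. -/
def baseChangeAlgEquiv : L ⊗[k] H ≃ₐ[L] B :=
  Algebra.TensorProduct.algEquivOfLinearEquivTensorProduct hH.isBaseChange.equiv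
    (fun l l' x x' => by simp [IsBaseChange.equiv_tmul, smul_smul, mul_comm])
    (by simp [IsBaseChange.equiv_tmul])

lemma toLinearMap_baseChangeAlgEquiv :
    hH.baseChangeAlgEquiv.toLinearMap = H.val.toLinearMap.liftBaseChange L := by
  ext x
  exact (hH.isBaseChange.equiv_tmul 1 x).trans (by simp)

lemma baseChangeAlgEquiv_tmul (l : L) (x : H) : hH.baseChangeAlgEquiv (l ⊗ₜ x) = l • (x : B) :=
  LinearMap.congr_fun hH.toLinearMap_baseChangeAlgEquiv _

variable [Module.FaithfullyFlat k L]

lemma injective_tensorRestrict : Function.Injective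
    (tensorRestrict L H.val.toLinearMap H.val.toLinearMap) :=
  injective_of_isBaseChange (isBaseChange_tensorRestrict hH.isBaseChange hH.isBaseChange)

/-- The restriction to `H` of the comultiplication. -/
def comul : H →ₗ[k] H ⊗[k] H :=
  LinearMap.codRestrictOfInjective
    ((Coalgebra.comul (R := L)).restrictScalars k ∘ₗ H.val.toLinearMap)
    (tensorRestrict L H.val.toLinearMap H.val.toLinearMap) hH.injective_tensorRestrict
    hH.comul_mem

/-- The restriction to `H` of the counit. -/
def counit : H →ₗ[k] k :=
  LinearMap.codRestrictOfInjective
    ((Coalgebra.counit (R := L)).restrictScalars k ∘ₗ H.val.toLinearMap)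
    (Algebra.linearMap k L) (injective_linearMap_of_faithfullyFlat k L) hH.counit_mem

omit [Module.FaithfullyFlat k L] in
/-- The restriction to `H` of the antipode. -/
def antipode : H →ₗ[k] H :=
  ((HopfAlgebra.antipode L).restrictScalars k ∘ₗ H.val.toLinearMap).codRestrict
    (Subalgebra.toSubmodule H) hH.antipode_mem

lemma tensorRestrict_comul (x : H) :
    tensorRestrict L H.val.toLinearMap H.val.toLinearMap (hH.comul x) =
      Coalgebra.comul (R := L) (x : B) :=
  LinearMap.codRestrictOfInjective_comp_apply ..

lemma algebraMap_counit (x : H) :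
    algebraMap k L (hH.counit x) = Coalgebra.counit (R := L) (x : B) :=
  LinearMap.codRestrictOfInjective_comp_apply _ (Algebra.linearMap k L) _ _ _

lemma comul_coassoc (x : H) :
    TensorProduct.assoc k H H H (hH.comul.rTensor H (hH.comul x)) =
      hH.comul.lTensor H (hH.comul x) := by
  let i := H.val.toLinearMap
  have injective : Function.Injective (tensorRestrict L i (tensorRestrict L i i)) :=
    injective_of_isBaseChange (isBaseChange_tensorRestrict hH.isBaseChange
      (isBaseChange_tensorRestrict hH.isBaseChange hH.isBaseChange))
  apply injective
  rw [tensorRestrict_assoc, tensorRestrict_rTensor (i := i) hH.tensorRestrict_comul,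
    tensorRestrict_lTensor (j := i) hH.tensorRestrict_comul, hH.tensorRestrict_comul]
  exact Coalgebra.coassoc_apply (x : B)

lemma rTensor_counit_comul (x : H) : hH.counit.rTensor H (hH.comul x) = 1 ⊗ₜ x := by
  apply (TensorProduct.lid k H).injective
  apply Subtype.val_injective
  change H.val.toLinearMap _ = _
  rw [← lid_tensorRestrict (L := L),
    tensorRestrict_rTensor (i := H.val.toLinearMap) hH.algebraMap_counit, hH.tensorRestrict_comul]
  exact (congrArg (TensorProduct.lid L B) (Coalgebra.rTensor_counit_comul (x : B))).trans (by simp)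

lemma lTensor_counit_comul (x : H) : hH.counit.lTensor H (hH.comul x) = x ⊗ₜ 1 := by
  apply (TensorProduct.rid k H).injective
  apply Subtype.val_injective
  change H.val.toLinearMap _ = _
  rw [← rid_tensorRestrict (L := L),
    tensorRestrict_lTensor (j := H.val.toLinearMap) hH.algebraMap_counit, hH.tensorRestrict_comul]
  exact (congrArg (TensorProduct.rid L B) (Coalgebra.lTensor_counit_comul (x : B))).trans (by simp)

lemma mul'_rTensor_antipode_comul (x : H) :
    LinearMap.mul' k H (hH.antipode.rTensor H (hH.comul x)) = algebraMap k H (hH.counit x) := by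
  apply Subtype.val_injective
  change H.val _ = _
  rw [← mul'_tensorRestrict (L := L),
    tensorRestrict_rTensor (i := H.val.toLinearMap) (f' := HopfAlgebra.antipode L)
      fun _ => rfl,
    hH.tensorRestrict_comul, Subalgebra.coe_algebraMap, IsScalarTower.algebraMap_apply k L B,
    hH.algebraMap_counit]
  exact HopfAlgebra.mul_antipode_rTensor_comul_apply (x : B)

lemma mul'_lTensor_antipode_comul (x : H) :
    LinearMap.mul' k H (hH.antipode.lTensor H (hH.comul x)) = algebraMap k H (hH.counit x) := by
  apply Subtype.val_injective
  change H.val _ = _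
  rw [← mul'_tensorRestrict (L := L),
    tensorRestrict_lTensor (j := H.val.toLinearMap) (g' := HopfAlgebra.antipode L)
      fun _ => rfl,
    hH.tensorRestrict_comul, Subalgebra.coe_algebraMap, IsScalarTower.algebraMap_apply k L B,
    hH.algebraMap_counit]
  exact HopfAlgebra.mul_antipode_lTensor_comul_apply (x : B)

/-- The coalgebra structure of a form. -/
abbrev toCoalgebra : Coalgebra k H where
  comul := hH.comul
  counit := hH.counit
  coassoc := LinearMap.ext hH.comul_coassoc
  rTensor_counit_comp_comul := LinearMap.ext hH.rTensor_counit_comul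
  lTensor_counit_comp_comul := LinearMap.ext hH.lTensor_counit_comul

lemma counit_one : hH.counit 1 = 1 := by
  apply injective_linearMap_of_faithfullyFlat k L
  simp [hH.algebraMap_counit]

lemma counit_mul (x y : H) : hH.counit (x * y) = hH.counit x * hH.counit y := by
  apply injective_linearMap_of_faithfullyFlat k L
  simp [hH.algebraMap_counit]

lemma comul_one : hH.comul 1 = 1 := by
  apply hH.injective_tensorRestrict
  rw [hH.tensorRestrict_comul]
  simp [Algebra.TensorProduct.one_def]

lemma comul_mul (x y : H) : hH.comul (x * y) = hH.comul x * hH.comul y := by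
  apply hH.injective_tensorRestrict
  simp [tensorRestrict_mul, hH.tensorRestrict_comul]

/-- The bialgebra structure of a form. -/
abbrev toBialgebra : Bialgebra k H :=
  letI := hH.toCoalgebra
  Bialgebra.mk' k H hH.counit_one (hH.counit_mul _ _) hH.comul_one (hH.comul_mul _ _)

/-- The Hopf algebra structure of a form. -/
abbrev toHopfAlgebra : HopfAlgebra k H where
  __ := hH.toBialgebra
  antipode := hH.antipode
  mul_antipode_rTensor_comul := LinearMap.ext hH.mul'_rTensor_antipode_comul
  mul_antipode_lTensor_comul := LinearMap.ext hH.mul'_lTensor_antipode_comul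

/-- The isomorphism `L ⊗[k] H ≃ B` of Hopf algebras over `L`. -/
def baseChangeEquiv : letI := hH.toHopfAlgebra; L ⊗[k] H ≃ₐc[L] B :=
  letI := hH.toHopfAlgebra
  .ofAlgEquiv hH.baseChangeAlgEquiv
    (by
      ext x
      have : algebraMap k L (Coalgebra.counit x) = Coalgebra.counit (R := L) (x : B) :=
        hH.algebraMap_counit x
      simp [baseChangeAlgEquiv_tmul, ← this, Algebra.smul_def])
    (by
      ext x
      change TensorProduct.map hH.baseChangeAlgEquiv.toLinearMap
        hH.baseChangeAlgEquiv.toLinearMap (Coalgebra.comul (R := L) ((1 : L) ⊗ₜ[k] x)) =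
          Coalgebra.comul (R := L) (hH.baseChangeAlgEquiv ((1 : L) ⊗ₜ[k] x))
      rw [TensorProduct.comul_tmul, baseChangeAlgEquiv_tmul, one_smul, ← hH.tensorRestrict_comul,
        toLinearMap_baseChangeAlgEquiv]
      exact map_liftBaseChange_tensorTensorTensorComm _ _ (hH.comul x))

end IsHopfForm

end HopfForm

/-! ### Galois descent -/

section GaloisDescent

variable {k L V W : Type*} [Field k] [Field L] [Algebra k L]
  [AddCommGroup V] [Module k V] [Module L V] [AddCommGroup W] [Module k W] [Module L W]

lemma linearIndependent_apply_basis {ι : Type*} (b : Module.Basis ι k L) :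
    LinearIndependent L fun (g : Gal(L/k)) (i : ι) => g (b i) := by
  have dedekind := (linearIndependent_toLinearMap k L L).comp (fun g : Gal(L/k) => (g : L →ₐ[k] L))
    fun g h e => AlgEquiv.ext fun x => AlgHom.congr_fun e x
  rw [linearIndependent_iff'] at dedekind ⊢
  intro s a ha
  refine dedekind s a (b.ext fun i => ?_)
  simpa using congrFun ha i

variable (k L) in
open Classical in
lemma exists_sum_mul_apply_eq_ite [FiniteDimensional k L] : ∃ (n : ℕ) (c l : Fin n → L),
    ∀ g : Gal(L/k), ∑ i, c i * g (l i) = if g = 1 then 1 else 0 := by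
  let b := Module.finBasis k L
  obtain ⟨φ, hφ⟩ := LinearMap.exists_leftInverse_of_injective
    (Finsupp.linearCombination L fun (g : Gal(L/k)) i => g (b i))
    (LinearMap.ker_eq_bot.2 (linearIndependent_apply_basis b))
  refine ⟨_, fun i => φ (Pi.single i 1) 1, b, fun g => ?_⟩
  calc ∑ i, φ (Pi.single i 1) 1 * g (b i)
      = (Finsupp.lapply 1 ∘ₗ φ) fun i => g (b i) := by
        rw [pi_eq_sum_univ' fun i => g (b i), map_sum]
        simp [mul_comm]
    _ = Finsupp.single g 1 1 := by
        simpa using DFunLike.congr_fun (LinearMap.congr_fun hφ (Finsupp.single g 1)) 1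
    _ = if g = 1 then 1 else 0 := Finsupp.single_apply

open Classical in
lemma sum_trace_mul_smul [FiniteDimensional k L] [IsGalois k L] {n : ℕ} {c l : Fin n → L}
    (hcl : ∀ g : Gal(L/k), ∑ i, c i * g (l i) = if g = 1 then 1 else 0) (a : L) :
    ∑ i, Algebra.trace k L (l i * a) • c i = a := by
  simp only [Algebra.smul_def, trace_eq_sum_automorphisms, map_mul, Finset.sum_mul]
  rw [Finset.sum_comm]
  simp only [mul_right_comm _ _ (c _), mul_comm _ (c _), ← Finset.sum_mul, hcl]
  simp

/-- A representation of `Gal(L/k)` over `k` on a vector space over `L` is semilinear if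
`g (l • v) = g l • g v`. -/
def IsSemilinear (ρ : Representation k Gal(L/k) V) : Prop :=
  ∀ (g : Gal(L/k)) (l : L) (v : V), ρ g (l • v) = g l • ρ g v

namespace IsSemilinear

variable {ρ : Representation k Gal(L/k) V} (hρ : IsSemilinear ρ)
  {τ : Representation k Gal(L/k) W} (hτ : IsSemilinear τ)

/-- A semilinear representation, as a family of semilinear maps. -/
def toSemilinearMap (g : Gal(L/k)) : V →ₛₗ[((g : L →+* L))] V where
  __ := ρ g
  map_smul' := hρ g

@[simp]
lemma toSemilinearMap_apply (g : Gal(L/k)) (v : V) : hρ.toSemilinearMap g v = ρ g v := rfl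

section Tensor

variable [IsScalarTower k L V]

/-- The tensor product over `L` of semilinear representations. -/
def tensor : Representation k Gal(L/k) (V ⊗[L] W) where
  toFun g :=
    { __ := TensorProduct.map (hρ.toSemilinearMap g) (hτ.toSemilinearMap g)
      map_smul' c w := by
        change TensorProduct.map _ _ (c • w) = c • TensorProduct.map _ _ w
        rw [← algebraMap_smul L c w, map_smulₛₗ, RingHom.coe_coe, AlgEquiv.commutes,
          algebraMap_smul] }
  map_one' := by
    ext w
    change TensorProduct.map _ _ w = w
    induction w with
    | zero => simp
    | add v w hv hw => rw [map_add, hv, hw]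
    | tmul v w => simp
  map_mul' g h := by
    ext w
    change TensorProduct.map _ _ w = TensorProduct.map _ _ (TensorProduct.map _ _ w)
    induction w with
    | zero => simp
    | add v w hv hw => simp only [map_add, hv, hw]
    | tmul v w => simp

@[simp]
lemma tensor_apply_tmul (g : Gal(L/k)) (v : V) (w : W) :
    hρ.tensor hτ g (v ⊗ₜ w) = ρ g v ⊗ₜ τ g w := rfl

lemma isSemilinear_tensor : IsSemilinear (hρ.tensor hτ) := fun g =>
  (TensorProduct.map (hρ.toSemilinearMap g) (hτ.toSemilinearMap g)).map_smulₛₗ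

end Tensor

include hρ

variable [FiniteDimensional k L]

open Classical in
lemma sum_smul_norm_smul {n : ℕ} {c l : Fin n → L}
    (hcl : ∀ g : Gal(L/k), ∑ i, c i * g (l i) = if g = 1 then 1 else 0) (v : V) :
    ∑ i, c i • ρ.norm (l i • v) = v := by
  simp only [Representation.norm, LinearMap.sum_apply, hρ _, Finset.smul_sum, smul_smul]
  rw [Finset.sum_comm]
  simp [← Finset.sum_smul, hcl]

variable [IsGalois k L] [IsScalarTower k L V]

lemma norm_smul_of_mem_invariants (l : L) {v : V} (hv : v ∈ ρ.invariants) :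
    ρ.norm (l • v) = Algebra.trace k L l • v := by
  rw [← algebraMap_smul L (Algebra.trace k L l), trace_eq_sum_automorphisms, Finset.sum_smul,
    Representation.norm, LinearMap.sum_apply]
  exact Finset.sum_congr rfl fun g _ => by rw [hρ, hv g]

lemma exists_norm_smul_eq : ∃ a : L, ∀ v ∈ ρ.invariants, ρ.norm (a • v) = v := by
  obtain ⟨a, ha⟩ := Algebra.trace_surjective k L 1
  exact ⟨a, fun v hv => by rw [hρ.norm_smul_of_mem_invariants a hv, ha, one_smul]⟩

lemma norm_mem_of_mem_span {W : Submodule k V} (hW : W ≤ ρ.invariants) {v : V}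
    (hv : v ∈ Submodule.span L (W : Set V)) : ρ.norm v ∈ W := by
  suffices ∀ l : L, ρ.norm (l • v) ∈ W by simpa using this 1
  induction hv using Submodule.span_induction with
  | mem v hv =>
    intro l
    rw [hρ.norm_smul_of_mem_invariants l (hW hv)]
    exact W.smul_mem _ hv
  | zero => simp
  | add v w _ _ hv hw => exact fun l => by simpa using add_mem (hv l) (hw l)
  | smul a v _ hv => exact fun l => by simpa only [smul_smul] using hv (l * a)

lemma invariants_le_of_span_eq_top {W : Submodule k V} (hW : W ≤ ρ.invariants)
    (span_eq_top : Submodule.span L (W : Set V) = ⊤) : ρ.invariants ≤ W := by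
  intro v hv
  obtain ⟨a, ha⟩ := hρ.exists_norm_smul_eq
  rw [← ha v hv]
  exact hρ.norm_mem_of_mem_span hW (span_eq_top ▸ Submodule.mem_top)

lemma isBaseChange_invariants : IsBaseChange L ρ.invariants.subtype := by
  classical
  obtain ⟨n, c, l, hcl⟩ := exists_sum_mul_apply_eq_ite k L
  let f : L ⊗[k] ρ.invariants →ₗ[L] V := ρ.invariants.subtype.liftBaseChange L
  let norm : V →ₗ[k] ρ.invariants := ρ.norm.codRestrict _ fun v g => ρ.self_norm_apply g v
  let r : V →ₗ[k] L ⊗[k] ρ.invariants :=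
    ∑ i, TensorProduct.mk k L ρ.invariants (c i) ∘ₗ norm ∘ₗ Algebra.lsmul k k V (l i)
  have hr (v : V) : r v = ∑ i, c i ⊗ₜ norm (l i • v) := by simp [r]
  have right_inv (v : V) : f (r v) = v := by
    rw [hr, map_sum]
    exact hρ.sum_smul_norm_smul hcl v
  have left_inv (w : L ⊗[k] ρ.invariants) : r (f w) = w := by
    induction w with
    | zero => simp
    | add v w hv hw => rw [map_add, map_add, hv, hw]
    | tmul a v =>
      have norm_smul (l : L) : norm (l • (v : V)) = Algebra.trace k L l • v :=
        Subtype.ext (hρ.norm_smul_of_mem_invariants l v.2)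
      rw [hr]
      simp only [f, LinearMap.liftBaseChange_tmul, Submodule.subtype_apply, smul_smul, norm_smul,
        ← TensorProduct.smul_tmul, ← TensorProduct.sum_tmul, sum_trace_mul_smul hcl]
  exact .of_equiv (.ofBijective f ⟨Function.LeftInverse.injective left_inv,
    Function.RightInverse.surjective right_inv⟩) fun v =>
      (LinearMap.liftBaseChange_tmul ..).trans (one_smul L _)

end IsSemilinear

end GaloisDescent

/-! ### Galois actions on Hopf algebras -/

section GaloisHopfAction

variable (k L : Type*) [Field k] [Field L] [Algebra k L]

/-- A semilinear action of `Gal(L/k)` on a Hopf algebra over `L` by ring automorphisms that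
commute with the comultiplication, the counit and the antipode. -/
structure GaloisHopfAction (B : Type*) [Ring B] [HopfAlgebra L B] [Algebra k B]
    [IsScalarTower k L B] where
  act : Gal(L/k) →* (B →ₐ[k] B)
  isSemilinear : IsSemilinear (L := L) (AlgHom.toEnd.comp act)
  comul_act (g : Gal(L/k)) (x : B) : Coalgebra.comul (R := L) (act g x) =
    isSemilinear.tensor isSemilinear g (Coalgebra.comul (R := L) x)
  counit_act (g : Gal(L/k)) (x : B) :
    Coalgebra.counit (R := L) (act g x) = g (Coalgebra.counit (R := L) x)
  antipode_act (g : Gal(L/k)) (x : B) :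
    HopfAlgebra.antipode L (act g x) = act g (HopfAlgebra.antipode L x)

namespace GaloisHopfAction

variable {k L} {B : Type*} [Ring B] [HopfAlgebra L B] [Algebra k B] [IsScalarTower k L B]
  (σ : GaloisHopfAction k L B)

/-- The `k`-algebra of invariants of a Galois action. -/
def fixed : Subalgebra k B :=
  Representation.invariants (AlgHom.toEnd.comp σ.act) |>.toSubalgebra (fun g => map_one (σ.act g))
    fun x y hx hy g => (map_mul (σ.act g) x y).trans (congrArg₂ _ (hx g) (hy g))

lemma act_of_mem {x : B} (hx : x ∈ σ.fixed) (g : Gal(L/k)) : σ.act g x = x := hx g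

section Trace

variable [FiniteDimensional k L]

/-- The trace map `x ↦ ∑ g, g x` to the invariants. -/
def trace : B →ₗ[k] σ.fixed :=
  (Representation.norm (AlgHom.toEnd.comp σ.act)).codRestrict (Subalgebra.toSubmodule σ.fixed)
    fun x g => Representation.self_norm_apply _ g x

lemma coe_trace (x : B) : (σ.trace x : B) = ∑ g, σ.act g x :=
  LinearMap.sum_apply ..

lemma trace_mul_coe (x : B) (y : σ.fixed) : σ.trace (x * y) = σ.trace x * y := by
  ext
  simp only [coe_trace, MulMemClass.coe_mul, map_mul, σ.act_of_mem y.2, Finset.sum_mul]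

variable [IsGalois k L]

lemma trace_surjective : Function.Surjective σ.trace := fun x =>
  have ⟨a, ha⟩ := σ.isSemilinear.exists_norm_smul_eq
  ⟨a • x, Subtype.ext (ha x x.2)⟩

lemma isBaseChange_fixed : IsBaseChange L σ.fixed.val.toLinearMap :=
  σ.isSemilinear.isBaseChange_invariants

/-- The comultiplication maps invariants to invariants of `B ⊗[L] B`, and by descent those come
from `fixed ⊗[k] fixed` because this subspace already spans `B ⊗[L] B` over `L`. -/
lemma comul_mem_of_mem_fixed {x : B} (hx : x ∈ σ.fixed) : Coalgebra.comul (R := L) x ∈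
    LinearMap.range (tensorRestrict L σ.fixed.val.toLinearMap σ.fixed.val.toLinearMap) := by
  have isBaseChange := isBaseChange_tensorRestrict σ.isBaseChange_fixed σ.isBaseChange_fixed
  refine (IsSemilinear.isSemilinear_tensor σ.isSemilinear
    σ.isSemilinear).invariants_le_of_span_eq_top ?_
      (span_range_eq_top_of_isBaseChange isBaseChange) fun g => ?_
  · rintro _ ⟨w, rfl⟩ g
    induction w with
    | zero => simp
    | add v w hv hw => rw [map_add, map_add, hv, hw]
    | tmul x y => exact congrArg₂ (· ⊗ₜ ·) (x.2 g) (y.2 g)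
  · rw [← σ.comul_act, σ.act_of_mem hx]

lemma isHopfForm_fixed : IsHopfForm L σ.fixed where
  isBaseChange := σ.isBaseChange_fixed
  comul_mem x := σ.comul_mem_of_mem_fixed x.2
  counit_mem x := (IsGalois.mem_range_algebraMap_iff_fixed _).2 fun g => by
    rw [← σ.counit_act, σ.act_of_mem x.2]
  antipode_mem x g := (σ.antipode_act g x).symm.trans (congrArg _ (σ.act_of_mem x.2 g))

end Trace

end GaloisHopfAction

end GaloisHopfAction

/-! ### Twisted forms -/

section TwistedForm

open WithConv in
lemma antipode_map {R A A' : Type*} [CommSemiring R] [Semiring A] [Semiring A'] [HopfAlgebra R A]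
    [HopfAlgebra R A'] (f : A →ₐc[R] A') (x : A) :
    HopfAlgebra.antipode R (f x) = f (HopfAlgebra.antipode R x) := by
  have left_inv : toConv (f.toLinearMap ∘ₗ HopfAlgebra.antipode R) * toConv f.toLinearMap = 1 := by
    have := LinearMap.algHom_comp_convMul_distrib (f : A →ₐ[R] A')
      (toConv (HopfAlgebra.antipode R)) (toConv LinearMap.id)
    rw [LinearMap.antipode_mul_id, LinearMap.algHom_comp_convOne] at this
    exact (ofConv_injective this).symm
  have right_inv : toConv f.toLinearMap * toConv (HopfAlgebra.antipode R ∘ₗ f.toLinearMap) = 1 := by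
    have := LinearMap.convMul_comp_coalgHom_distrib (toConv LinearMap.id)
      (toConv (HopfAlgebra.antipode R)) (f : A →ₗc[R] A')
    rw [LinearMap.id_mul_antipode, LinearMap.convOne_comp_coalgHom] at this
    exact (ofConv_injective this).symm
  exact (LinearMap.congr_fun (congrArg ofConv (left_inv_eq_right_inv left_inv right_inv)) x).symm

variable {k : Type*} (L : Type*) {C : Type*} [Field k] [Field L] [Algebra k L] [Ring C]

section Algebra

variable [Algebra k C]

/-- The action `g (l ⊗ c) = g l ⊗ ρ g c` of `Gal(L/k)` on `L ⊗[k] C`. -/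
def twist (ρ : Gal(L/k) →* (C →ₐ[k] C)) : Gal(L/k) →* (L ⊗[k] C →ₐ[k] L ⊗[k] C) where
  toFun g := Algebra.TensorProduct.map (g : L →ₐ[k] L) (ρ g)
  map_one' := by ext <;> simp
  map_mul' g h := by ext <;> simp

variable {L}

@[simp]
lemma twist_apply_tmul (ρ : Gal(L/k) →* (C →ₐ[k] C)) (g : Gal(L/k)) (l : L) (c : C) :
    twist L ρ g (l ⊗ₜ c) = g l ⊗ₜ ρ g c := rfl

lemma isSemilinear_twist (ρ : Gal(L/k) →* (C →ₐ[k] C)) :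
    IsSemilinear (L := L) (AlgHom.toEnd.comp (twist L ρ)) := fun g l x => by
  induction x with
  | zero => simp
  | add a b ha hb => simp only [smul_add, map_add, ha, hb]
  | tmul a c => simp [TensorProduct.smul_tmul']

end Algebra

variable [HopfAlgebra k C]

variable (k C) in
/-- The forgetful homomorphism from the endomorphisms of a bialgebra to those of the underlying
algebra. -/
def bialgEndToAlgEnd : (C →ₐc[k] C) →* (C →ₐ[k] C) where
  toFun := BialgHom.toAlgHom
  map_one' := rfl
  map_mul' _ _ := rfl

@[simp]
lemma bialgEndToAlgEnd_apply (f : C →ₐc[k] C) (c : C) : bialgEndToAlgEnd k C f c = f c := rfl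

variable {L} in
lemma comul_twist_tmul (ρ : Gal(L/k) →* (C →ₐc[k] C)) (g : Gal(L/k)) (a : L) (c : C) :
    letI semilinear := isSemilinear_twist (L := L) ((bialgEndToAlgEnd k C).comp ρ)
    Coalgebra.comul (R := L) (twist L ((bialgEndToAlgEnd k C).comp ρ) g (a ⊗ₜ c)) =
      semilinear.tensor semilinear g (Coalgebra.comul (R := L) (a ⊗ₜ c)) := by
  rw [twist_apply_tmul, TensorProduct.comul_tmul, TensorProduct.comul_tmul, MonoidHom.comp_apply,
    bialgEndToAlgEnd_apply, ← CoalgHomClass.map_comp_comul_apply (ρ g)]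
  induction Coalgebra.comul (R := k) c with
  | zero => simp
  | add v w hv hw => simp only [TensorProduct.tmul_add, map_add, hv, hw]
  | tmul v w => simp

/-- The Galois action on `L ⊗[k] C` given by an action of `Gal(L/k)` on the Hopf algebra `C`. -/
def twistAction (ρ : Gal(L/k) →* (C →ₐc[k] C)) : GaloisHopfAction k L (L ⊗[k] C) where
  act := twist L ((bialgEndToAlgEnd k C).comp ρ)
  isSemilinear := isSemilinear_twist _
  comul_act g x := by
    induction x with
    | zero => simp
    | add a b ha hb => simp only [map_add, ha, hb]
    | tmul a c => exact comul_twist_tmul ρ g a c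
  counit_act g x := by
    induction x with
    | zero => simp
    | add a b ha hb => simp only [map_add, ha, hb]
    | tmul a c => simp
  antipode_act g x := by
    induction x with
    | zero => simp
    | add a b ha hb => simp only [map_add, ha, hb]
    | tmul a c => simp [antipode_map]

end TwistedForm

/-! ### The semidirect product: functoriality and generators -/

namespace SemidirectHopf

variable {k T N : Type*} [CommRing k] [Group T] [Group N] {ψ : N →* MulAut T}

section Map

/-- The linear endomorphism `e_t ⊗ n ↦ e_{θ t} ⊗ n` of `k[T] ⋊ kN`. -/
def mapLinear (θ : T → T) : SemidirectHopf k ψ →ₗ[k] SemidirectHopf k ψ :=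
  (basis k ψ).constr k fun p => basis k ψ (θ p.1, p.2)

lemma mapLinear_basis (θ : T → T) (p : T × N) :
    mapLinear θ (basis k ψ p) = basis k ψ (θ p.1, p.2) :=
  (basis k ψ).constr_basis ..

lemma mapLinear_mul {θ : MulAut T} (hθ : ∀ n t, θ (ψ n t) = ψ n (θ t))
    (a b : SemidirectHopf k ψ) :
    mapLinear θ (a * b) = mapLinear θ a * mapLinear θ b := by
  classical
  induction a using induction_basis with
  | zero => simp only [zero_mul, map_zero]
  | add a a' ha ha' => simp only [add_mul, map_add, ha, ha']
  | smul r a ha => simp only [smul_mul_assoc, map_smul, ha]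
  | basis p =>
  induction b using induction_basis with
  | zero => simp only [mul_zero, map_zero]
  | add b b' hb hb' => simp only [mul_add, map_add, hb, hb']
  | smul r b hb => simp only [mul_smul_comm, map_smul, hb]
  | basis q =>
    simp only [basis_mul_basis, mapLinear_basis, apply_ite (mapLinear θ), map_zero, ← hθ,
      θ.injective.eq_iff]

variable [Fintype T] (θ : MulAut T)

lemma mapLinear_one : mapLinear θ (1 : SemidirectHopf k ψ) = 1 := by
  simp only [one_def, map_sum, mapLinear_basis]
  exact Fintype.sum_equiv θ.toEquiv _ _ fun t => rfl

lemma counit_mapLinear (a : SemidirectHopf k ψ) :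
    Coalgebra.counit (R := k) (mapLinear θ a) = Coalgebra.counit (R := k) a := by
  classical
  refine LinearMap.congr_fun (f := Coalgebra.counit ∘ₗ mapLinear θ) ((basis k ψ).ext fun p => ?_) a
  simp [mapLinear_basis, counit_basis]

lemma map_mapLinear_comul (a : SemidirectHopf k ψ) :
    TensorProduct.map (mapLinear θ) (mapLinear θ) (Coalgebra.comul (R := k) a) =
      Coalgebra.comul (R := k) (mapLinear θ a) := by
  refine LinearMap.congr_fun (f := TensorProduct.map (mapLinear θ) (mapLinear θ) ∘ₗ Coalgebra.comul)
    (g := Coalgebra.comul ∘ₗ mapLinear θ) ((basis k ψ).ext fun p => ?_) a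
  simp only [LinearMap.comp_apply, mapLinear_basis, comul_basis, map_sum, TensorProduct.map_tmul]
  exact Fintype.sum_equiv θ.toEquiv _ _ fun t => by simp

variable {θ} in
/-- The endomorphism of `k[T] ⋊ kN` induced by an automorphism of `T` that commutes with `N`. -/
def mapAut (hθ : ∀ n t, θ (ψ n t) = ψ n (θ t)) : SemidirectHopf k ψ →ₐc[k] SemidirectHopf k ψ :=
  .ofAlgHom (.ofLinearMap (mapLinear θ) (mapLinear_one θ) (mapLinear_mul hθ))
    (AlgHom.ext (counit_mapLinear θ)) (AlgHom.ext (map_mapLinear_comul θ))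

variable {θ} in
lemma mapAut_basis (hθ : ∀ n t, θ (ψ n t) = ψ n (θ t)) (p : T × N) :
    mapAut (k := k) hθ (basis k ψ p) = basis k ψ (θ p.1, p.2) :=
  mapLinear_basis θ p

/-- The action on `k[T] ⋊ kN` of a group that acts on `T` by automorphisms commuting with `N`. -/
def mapHom {G : Type*} [Group G] (θ : G →* MulAut T) (hθ : ∀ g n t, θ g (ψ n t) = ψ n (θ g t)) :
    G →* (SemidirectHopf k ψ →ₐc[k] SemidirectHopf k ψ) where
  toFun g := mapAut (hθ g)
  map_one' := BialgHom.coe_linearMap_injective ((basis k ψ).ext fun p => by simp [mapAut_basis])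
  map_mul' g h :=
    BialgHom.coe_linearMap_injective ((basis k ψ).ext fun p => by simp [mapAut_basis])

lemma mapHom_basis {G : Type*} [Group G] (θ : G →* MulAut T)
    (hθ : ∀ g n t, θ g (ψ n t) = ψ n (θ g t)) (g : G) (p : T × N) :
    mapHom (k := k) θ hθ g (basis k ψ p) = basis k ψ (θ g p.1, p.2) :=
  mapAut_basis (hθ g) p

end Map

section Generators

variable [Fintype T]

variable (k ψ) in
/-- The embedding `n ↦ 1 ⊗ n` of the group `N` into `k[T] ⋊ kN`. -/
def ofGroup : N →* SemidirectHopf k ψ where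
  toFun n := ∑ t, basis k ψ (t, n)
  map_one' := rfl
  map_mul' n m := by
    classical
    rw [Finset.sum_mul_sum]
    refine Finset.sum_congr rfl fun t _ => ?_
    simp [basis_mul_basis, ← MulEquiv.symm_apply_eq]

lemma ofGroup_apply (n : N) : ofGroup k ψ n = ∑ t, basis k ψ (t, n) := rfl

lemma ofGroup_mul_basis (n : N) (p : T × N) :
    ofGroup k ψ n * basis k ψ p = basis k ψ (ψ n p.1, n * p.2) := by
  classical
  simp [ofGroup_apply, Finset.sum_mul, basis_mul_basis]

lemma basis_mul_ofGroup (p : T × N) (n : N) :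
    basis k ψ p * ofGroup k ψ n = basis k ψ (p.1, p.2 * n) := by
  classical
  simp [ofGroup_apply, Finset.mul_sum, basis_mul_basis, ← MulEquiv.symm_apply_eq]

variable {L : Type*} [CommRing L] [Algebra k L]

variable (k ψ L) in
/-- The embedding of the function algebra `L[T]` into `L ⊗[k] (k[T] ⋊ kN)`. -/
def ofFun : (T → L) →ₐ[k] L ⊗[k] SemidirectHopf k ψ :=
  AlgHom.ofLinearMap
    (∑ t, (TensorProduct.mk k L (SemidirectHopf k ψ)).flip (basis k ψ (t, 1)) ∘ₗ LinearMap.proj t)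
    (by simp [Algebra.TensorProduct.one_def, one_def, TensorProduct.tmul_sum])
    (by
      classical
      intro f f'
      simp [Finset.sum_mul_sum, basis_mul_basis, TensorProduct.tmul_ite])

lemma ofFun_apply (f : T → L) : ofFun k ψ L f = ∑ t, f t ⊗ₜ basis k ψ (t, 1) := by
  simp [ofFun]

open Classical in
lemma ofFun_single (t : T) (l : L) : ofFun k ψ L (Pi.single t l) = l ⊗ₜ basis k ψ (t, 1) := by
  rw [ofFun_apply, Fintype.sum_eq_single t fun s hs => by simp [hs], Pi.single_eq_same]

lemma ofGroup_mul_ofFun (n : N) (f : T → L) :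
    ((1 : L) ⊗ₜ ofGroup k ψ n) * ofFun k ψ L f =
      ofFun k ψ L (f ∘ (ψ n).symm) * ((1 : L) ⊗ₜ ofGroup k ψ n) := by
  simp only [ofFun_apply, Finset.mul_sum, Finset.sum_mul, Algebra.TensorProduct.tmul_mul_tmul,
    ofGroup_mul_basis, basis_mul_ofGroup, one_mul, mul_one]
  exact Fintype.sum_equiv (ψ n).toEquiv _ _ fun t => by simp

open Classical in
lemma ofFun_single_mul_ofGroup (l : L) (p : T × N) :
    ofFun k ψ L (Pi.single p.1 l) * ((1 : L) ⊗ₜ ofGroup k ψ p.2) = l ⊗ₜ basis k ψ p := by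
  rw [ofFun_single, Algebra.TensorProduct.tmul_mul_tmul, basis_mul_ofGroup, one_mul, mul_one]

end Generators

end SemidirectHopf

/-! ### Maschke's theorem for a ring generated by a normalized subring -/

section Maschke

variable {R N M M' : Type*} [Ring R] [Group N] [Fintype N] [AddCommGroup M] [Module R M]
  [AddCommGroup M'] [Module R M'] {S : Subring R} (u : N →* Rˣ)

/-- The average (without the factor `1 / |N|`) of the conjugates of an additive map of modules over
a ring `R` under a finite group `N` that acts through the units of `R`. -/
def average (f : M →+ M') : M →+ M' where
  toFun x := ∑ n, u n • f ((u n)⁻¹ • x)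
  map_zero' := by simp
  map_add' x y := by simp only [smul_add, map_add, Finset.sum_add_distrib]

lemma average_apply (f : M →+ M') (x : M) : average u f x = ∑ n, u n • f ((u n)⁻¹ • x) := rfl

lemma average_units_smul (f : M →+ M') (m : N) (x : M) :
    average u f (u m • x) = u m • average u f x := by
  rw [average_apply, average_apply, Finset.smul_sum]
  exact Fintype.sum_equiv (Equiv.mulLeft m⁻¹) _ _ fun n => by simp [smul_smul]

variable {u}

lemma average_smul_of_mem (hu : ∀ n, ∀ s ∈ S, (u n * s * ↑(u n)⁻¹ : R) ∈ S) (f : M →ₗ[S] M')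
    {s : R} (hs : s ∈ S) (x : M) : average u (f : M →+ M') (s • x) = s • average u f x := by
  rw [average_apply, average_apply, Finset.smul_sum]
  refine Finset.sum_congr rfl fun n _ => ?_
  let s' : S := ⟨↑(u n)⁻¹ * s * u n, by simpa using hu n⁻¹ s hs⟩
  have inv_smul : (u n)⁻¹ • s • x = s' • (u n)⁻¹ • x := by
    simp [s', Subring.smul_def, Units.smul_def, smul_smul, mul_assoc]
  have smul_conj (y : M') : u n • s' • y = s • u n • y := by
    simp [s', Subring.smul_def, Units.smul_def, smul_smul, mul_assoc]
  rw [inv_smul, ← smul_conj]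
  exact congrArg _ (map_smul f s' _)

lemma average_smul (hu : ∀ n, ∀ s ∈ S, (u n * s * ↑(u n)⁻¹ : R) ∈ S)
    (closure_eq_top : Subring.closure (S ∪ Set.range fun n => (u n : R)) = ⊤) (f : M →ₗ[S] M')
    (r : R) (x : M) : average u (f : M →+ M') (r • x) = r • average u f x := by
  have hr : r ∈ Subring.closure (S ∪ Set.range fun n => (u n : R)) := closure_eq_top ▸ trivial
  induction hr using Subring.closure_induction generalizing x with
  | mem r hr =>
    obtain hr | ⟨n, rfl⟩ := hr
    · exact average_smul_of_mem hu f hr x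
    · exact average_units_smul u _ n x
  | zero => simp
  | one => simp
  | add r s _ _ hr hs => simp only [add_smul, map_add, hr, hs]
  | neg r _ hr => simp only [neg_smul, map_neg, hr]
  | mul r s _ _ hr hs => simp only [mul_smul, hr, hs]

lemma average_apply_of_mem {W : Submodule R M} {f : M →+ W} (hf : ∀ w : W, f w = w) (w : W) :
    average u f w = Nat.card N • w := by
  have (n : N) : f ((u n)⁻¹ • (w : M)) = (u n)⁻¹ • w := hf ((u n)⁻¹ • w)
  simp [average_apply, this]

omit [Fintype N] in
theorem isSemisimpleRing_of_normalizes {k : Type*} [CommRing k] [Algebra k R] [Finite N]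
    [IsSemisimpleRing S] (isUnit_card : IsUnit (Nat.card N : k))
    (hu : ∀ n, ∀ s ∈ S, (u n * s * ↑(u n)⁻¹ : R) ∈ S)
    (closure_eq_top : Subring.closure (S ∪ Set.range fun n => (u n : R)) = ⊤) :
    IsSemisimpleRing R := by
  have := Fintype.ofFinite N
  obtain ⟨c, hc⟩ := isUnit_card
  refine (isSemisimpleModule_iff R R).2 ⟨fun W => ?_⟩
  obtain ⟨W', hW'⟩ := exists_isCompl (W.restrictScalars S)
  let p : R →ₗ[S] W := Submodule.projectionOnto (W.restrictScalars S) W' hW'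
  let q : R →ₗ[R] W :=
    { average u (p : R →+ W) with map_smul' := average_smul hu closure_eq_top p }
  have hq (w : W) : q w = (c : k) • w := by
    rw [hc, Nat.cast_smul_eq_nsmul]
    exact average_apply_of_mem (Submodule.projectionOnto_apply_left hW') w
  exact ⟨_, LinearMap.isCompl_of_proj (f := (↑c⁻¹ : k) • q) fun w => by
    simp [hq, smul_smul]⟩

end Maschke

/-! ### The group `Ĝ` -/

lemma natCast_card_ne_zero_of_injective {N R : Type*} [Group N] [Finite N] [CommRing R] [IsDomain R]
    {f : N →* R} (hf : Function.Injective f) : (Nat.card N : R) ≠ 0 := by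
  have := isCyclic_of_injective_ringHom f hf
  obtain ⟨n, hn⟩ := IsCyclic.exists_ofOrder_eq_natCard (α := N)
  have : NeZero (Nat.card N) := ⟨Nat.card_pos.ne'⟩
  have isPrimitiveRoot : IsPrimitiveRoot (f n) (Nat.card N) :=
    hn ▸ orderOf_injective f hf n ▸ IsPrimitiveRoot.orderOf (f n)
  exact isPrimitiveRoot.neZero'.out

namespace CrossedProduct

variable {k L : Type*} [Field k] [Field L] [Algebra k L]
  {α : Gal(L/k) × Gal(L/k) → Lˣ} {hα : groupCohomology.IsMulCocycle₂ α}

variable (hα) in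
/-- The embedding `x ↦ x α(1,1)⁻¹ U_1` of `L` into the crossed product algebra. -/
def embed : L →ₐ[k] CrossedProduct α hα :=
  AlgHom.ofLinearMap (single hα 1 ∘ₗ LinearMap.mulRight k (↑(α (1, 1))⁻¹ : L))
    (by simp [one_def])
    (by
      intro x y
      simp only [LinearMap.comp_apply, LinearMap.mulRight_apply, single_mul_single, one_mul]
      congr 1
      simp
      field_simp)

lemma embed_apply (x : L) : embed hα x = single hα 1 (x * ↑(α (1, 1))⁻¹) := rfl

lemma embed_injective : Function.Injective (embed hα) := fun _ _ e =>
  mul_right_cancel₀ (Units.ne_zero _) (Finsupp.single_injective (1 : Gal(L/k)) e)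

lemma embed_mul_single (x y : L) (g : Gal(L/k)) :
    embed hα x * single hα g y = single hα g (x * y) := by
  rw [embed_apply, single_mul_single, one_mul, groupCohomology.map_one_fst_of_isMulCocycle₂ hα g,
    AlgEquiv.one_apply, mul_right_comm, Units.inv_mul_cancel_right]

lemma single_mul_embed (x y : L) (g : Gal(L/k)) :
    single hα g y * embed hα x = embed hα (g x) * single hα g y := by
  rw [embed_mul_single, embed_apply, single_mul_single, mul_one,
    congrArg Units.val (groupCohomology.map_one_snd_of_isMulCocycle₂ hα g)]
  congr 1
  simp [AlgEquiv.smul_units_def]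
  field_simp

lemma coe_mul_embed (u : Ghat α hα) (x : L) :
    ((u : (CrossedProduct α hα)ˣ) : CrossedProduct α hα) * embed hα x =
      embed hα (proj α hα u x) * ((u : (CrossedProduct α hα)ˣ) : CrossedProduct α hα) := by
  obtain ⟨y, hy⟩ := exists_eq_single_proj u
  rw [hy, single_mul_embed]

lemma coe_mem_range_embed (u : (proj α hα).ker) :
    ((u : (CrossedProduct α hα)ˣ) : CrossedProduct α hα) ∈ (embed hα).range := by
  obtain ⟨x, hx⟩ := exists_eq_single_proj (u : Ghat α hα)
  rw [MonoidHom.mem_ker.1 u.2] at hx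
  exact ⟨x * α (1, 1), by simp [hx, embed_apply]⟩

section Finite

lemma exists_eq_unitSingle_of_mem_Ghat {m : ℕ} (hm : ∀ p, α p ^ m = 1) {u : (CrossedProduct α hα)ˣ}
    (hu : u ∈ Ghat α hα) : ∃ g : Gal(L/k), ∃ x : Lˣ, x ^ m = 1 ∧ u = unitSingle hα g x := by
  have smul_pow_eq_one (g : Gal(L/k)) {x : Lˣ} (hx : x ^ m = 1) : (g • x) ^ m = 1 := by
    rw [← smul_pow', hx, smul_one]
  induction hu using Subgroup.closure_induction with
  | mem u hu => obtain ⟨g, rfl⟩ := hu; exact ⟨g, 1, one_pow _, rfl⟩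
  | one => exact ⟨1, (α (1, 1))⁻¹, by rw [inv_pow, hm, inv_one], Units.ext one_def⟩
  | mul u v _ _ hu hv =>
    obtain ⟨g, x, hx, rfl⟩ := hu
    obtain ⟨h, y, hy, rfl⟩ := hv
    exact ⟨g * h, x * g • y * α (g, h),
      by rw [mul_pow, mul_pow, hx, smul_pow_eq_one g hy, hm, one_mul, one_mul],
      Units.ext (single_mul_single g h (x : L) (y : L))⟩
  | inv u _ hu =>
    obtain ⟨g, x, hx, rfl⟩ := hu
    exact ⟨g⁻¹, (g⁻¹ • x)⁻¹ * (α (g⁻¹, g))⁻¹ * (α (1, 1))⁻¹,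
      by simp only [mul_pow, inv_pow, smul_pow_eq_one g⁻¹ hx, hm, inv_one, mul_one], Units.ext rfl⟩

lemma finite_Ghat [FiniteDimensional k L] (hfin : ∀ g h : Gal(L/k), IsOfFinOrder (α (g, h))) :
    Finite (Ghat α hα) := by
  classical
  let m := ∏ p, orderOf (α p)
  have : NeZero m := ⟨Finset.prod_ne_zero_iff.2 fun p _ => (hfin p.1 p.2).orderOf_pos.ne'⟩
  have hm p : α p ^ m = 1 :=
    orderOf_dvd_iff_pow_eq_one.1 (Finset.dvd_prod_of_mem _ (Finset.mem_univ p))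
  refine (Set.finite_range fun p : Gal(L/k) × rootsOfUnity m L =>
    unitSingle hα p.1 p.2).subset fun u hu => ?_
  obtain ⟨g, x, hx, rfl⟩ := exists_eq_unitSingle_of_mem_Ghat hm hu
  exact ⟨(g, ⟨x, hx⟩), rfl⟩

variable [Finite (Ghat α hα)]

lemma natCast_card_ker_proj_ne_zero : (Nat.card (proj α hα).ker : L) ≠ 0 := by
  let coe : (proj α hα).ker →* (embed hα).range :=
    ((Units.coeHom _).comp ((Ghat α hα).subtype.comp (Subgroup.subtype _))).codRestrict
      (embed hα).range coe_mem_range_embed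
  have coe_injective : Function.Injective coe := fun u v e =>
    Subtype.ext (Subtype.ext (Units.ext (congrArg Subtype.val e)))
  let toField := (AlgEquiv.ofInjective (embed hα) embed_injective).symm
  exact natCast_card_ne_zero_of_injective (f := (toField : _ →* L).comp coe)
    (toField.injective.comp coe_injective)

lemma natCast_card_Ghat_ne_zero (hG : ¬ ringChar k ∣ Nat.card Gal(L/k)) :
    (Nat.card (Ghat α hα) : k) ≠ 0 := by
  rw [← Subgroup.card_mul_index (proj α hα).ker, Subgroup.index_ker, Nat.cast_mul]
  refine mul_ne_zero (fun card_eq_zero => ?_) fun card_eq_zero => ?_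
  · exact natCast_card_ker_proj_ne_zero (hα := hα) (by
      rw [← map_natCast (algebraMap k L), card_eq_zero, map_zero])
  · exact hG (((ringChar.spec k _).1 card_eq_zero).trans (Subgroup.card_subgroup_dvd_card _))

end Finite

end CrossedProduct

/-! ### Twisted forms of the semidirect product -/

namespace SemidirectHopf

variable {k L T N : Type*} [Field k] [Field L] [Algebra k L] [Group T] [Group N] {ψ : N →* MulAut T}

@[elab_as_elim]
lemma induction_tmul_basis {P : L ⊗[k] SemidirectHopf k ψ → Prop} (x : L ⊗[k] SemidirectHopf k ψ)
    (zero : P 0) (add : ∀ x y, P x → P y → P (x + y))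
    (tmul : ∀ l p, P (l ⊗ₜ basis k ψ p)) : P x := by
  induction x with
  | zero => exact zero
  | add x y hx hy => exact add x y hx hy
  | tmul l c =>
    induction c using induction_basis generalizing l with
    | zero => simpa using zero
    | add a b ha hb => simpa [TensorProduct.tmul_add] using add _ _ (ha l) (hb l)
    | smul r a ha => simpa [TensorProduct.smul_tmul] using ha (r • l)
    | basis p => exact tmul l p

variable [Fintype T] (θ : Gal(L/k) →* MulAut T) (hθ : ∀ g n t, θ g (ψ n t) = ψ n (θ g t))

/-- The Galois action `g (l e_t ⊗ n) = g l e_{θ g t} ⊗ n` on `L ⊗[k] (k[T] ⋊ kN)`. -/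
def galoisAction : GaloisHopfAction k L (L ⊗[k] SemidirectHopf k ψ) :=
  twistAction L (mapHom θ hθ)

lemma galoisAction_tmul_basis (g : Gal(L/k)) (l : L) (p : T × N) :
    (galoisAction θ hθ).act g (l ⊗ₜ basis k ψ p) = g l ⊗ₜ basis k ψ (θ g p.1, p.2) :=
  (twist_apply_tmul _ g l _).trans (congrArg _ (mapHom_basis θ hθ g p))

lemma galoisAction_ofFun (g : Gal(L/k)) (f : T → L) :
    (galoisAction θ hθ).act g (ofFun k ψ L f) = ofFun k ψ L (g ∘ f ∘ (θ g).symm) := by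
  simp only [ofFun_apply, map_sum, galoisAction_tmul_basis]
  exact Fintype.sum_equiv (θ g).toEquiv _ _ fun t => by simp

lemma one_tmul_ofGroup_mem_fixed (n : N) :
    (1 : L) ⊗ₜ ofGroup k ψ n ∈ (galoisAction θ hθ).fixed := fun g => by
  simp only [ofGroup_apply, TensorProduct.tmul_sum, map_sum]
  exact Fintype.sum_equiv (θ g).toEquiv _ _ fun t =>
    (galoisAction_tmul_basis θ hθ g 1 _).trans (by simp)

/-- The homomorphism from `N` to the units of the form of `k[T] ⋊ kN`. -/
def toUnitsFixed : N →* (galoisAction θ hθ).fixedˣ :=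
  MonoidHom.toHomUnits ((Algebra.TensorProduct.includeRight.toMonoidHom.comp
    (ofGroup k ψ)).codRestrict (galoisAction θ hθ).fixed (one_tmul_ofGroup_mem_fixed θ hθ))

lemma coe_toUnitsFixed (n : N) :
    (toUnitsFixed θ hθ n : L ⊗[k] SemidirectHopf k ψ) = (1 : L) ⊗ₜ ofGroup k ψ n := rfl

/-- The ring of those functions on `T` that lie in the form of `k[T] ⋊ kN`. -/
def fixedFun : Subring (galoisAction θ hθ).fixed :=
  (ofFun k ψ L).toRingHom.range.comap (galoisAction θ hθ).fixed.val.toRingHom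

lemma conj_mem_fixedFun (n : N) {s : (galoisAction θ hθ).fixed} (hs : s ∈ fixedFun θ hθ) :
    toUnitsFixed θ hθ n * s * ↑(toUnitsFixed θ hθ n)⁻¹ ∈ fixedFun θ hθ := by
  obtain ⟨f, hf : ofFun k ψ L f = s⟩ := hs
  let u := Units.map (galoisAction θ hθ).fixed.val.toMonoidHom (toUnitsFixed θ hθ n)
  refine ⟨f ∘ (ψ n).symm, (Units.eq_mul_inv_iff_mul_eq u).2 ?_⟩
  exact (ofGroup_mul_ofFun n f).symm.trans (congrArg _ hf)

section FiniteDimensional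

variable [FiniteDimensional k L]

lemma trace_ofFun_mem_fixedFun (f : T → L) :
    (galoisAction θ hθ).trace (ofFun k ψ L f) ∈ fixedFun θ hθ := by
  refine Subring.mem_comap.2 ?_
  change ((galoisAction θ hθ).trace (ofFun k ψ L f) : L ⊗[k] SemidirectHopf k ψ) ∈ _
  rw [GaloisHopfAction.coe_trace]
  exact sum_mem fun g _ => ⟨_, (galoisAction_ofFun θ hθ g f).symm⟩

instance : IsSemisimpleRing (fixedFun θ hθ) := by
  let A : Subalgebra k (T → L) := (galoisAction θ hθ).fixed.comap (ofFun k ψ L)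
  have : IsReduced A := isReduced_of_injective A.val Subtype.val_injective
  have : IsArtinianRing A := IsArtinianRing.of_finite k A
  have := IsArtinianRing.isSemisimpleRing_of_isReduced A
  let toFixed : A →ₐ[k] (galoisAction θ hθ).fixed :=
    ((ofFun k ψ L).comp A.val).codRestrict _ Subtype.property
  refine RingHom.isSemisimpleRing_of_surjective
    (toFixed.toRingHom.codRestrict (fixedFun θ hθ) fun f => ⟨f, rfl⟩) ?_
  rintro ⟨x, f, hf⟩
  have mem_fixed : ofFun k ψ L f ∈ (galoisAction θ hθ).fixed := hf.symm ▸ x.2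
  exact ⟨⟨f, mem_fixed⟩, Subtype.ext (Subtype.ext hf)⟩

variable [IsGalois k L]

lemma closure_fixedFun_union_range_toUnitsFixed : Subring.closure
    (fixedFun θ hθ ∪ Set.range fun n => (toUnitsFixed θ hθ n : (galoisAction θ hθ).fixed)) = ⊤ := by
  classical
  refine (Subring.eq_top_iff' _).2 fun x => ?_
  obtain ⟨y, rfl⟩ := (galoisAction θ hθ).trace_surjective x
  induction y using induction_tmul_basis with
  | zero => exact map_zero (galoisAction θ hθ).trace ▸ zero_mem _
  | add y z hy hz => exact map_add (galoisAction θ hθ).trace y z ▸ add_mem hy hz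
  | tmul l p =>
    rw [← ofFun_single_mul_ofGroup, ← coe_toUnitsFixed θ hθ, GaloisHopfAction.trace_mul_coe]
    exact mul_mem (Subring.subset_closure (.inl (trace_ofFun_mem_fixedFun θ hθ _)))
      (Subring.subset_closure (.inr ⟨p.2, rfl⟩))

theorem isSemisimpleRing_fixed_galoisAction [Finite N] (isUnit_card : IsUnit (Nat.card N : k)) :
    IsSemisimpleRing (galoisAction θ hθ).fixed :=
  isSemisimpleRing_of_normalizes isUnit_card (fun n _ => conj_mem_fixedFun θ hθ n)
    (closure_fixedFun_union_range_toUnitsFixed θ hθ)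

end FiniteDimensional

end SemidirectHopf

/-! ### Evaluation of the form at a point -/

namespace SemidirectHopf

section Eval

variable {k L T N A : Type*} [Field k] [Field L] [Algebra k L] [Group T] [Group N]
  {ψ : N →* MulAut T} [Ring A] [Algebra k A] (i : L →ₐ[k] A) (u : N →* A) (t₀ : T)

variable (ψ) in
open Classical in
/-- The linear map `L ⊗[k] (k[T] ⋊ kN) → A`, `l e_t ⊗ n ↦ δ_{t, t₀} i l u n`, that evaluates
functions on `T` at `t₀`. -/
def evalMap : L ⊗[k] SemidirectHopf k ψ →ₗ[k] A :=
  LinearMap.mul' k A ∘ₗ TensorProduct.map i.toLinearMap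
    ((basis k ψ).constr k fun p => if p.1 = t₀ then u p.2 else 0)

open Classical in
lemma evalMap_tmul_basis (l : L) (p : T × N) :
    evalMap ψ i u t₀ (l ⊗ₜ basis k ψ p) = if p.1 = t₀ then i l * u p.2 else 0 := by
  simp [evalMap]

variable [Fintype T]

lemma evalMap_one : evalMap ψ i u t₀ 1 = 1 := by
  classical
  simp [Algebra.TensorProduct.one_def, one_def, TensorProduct.tmul_sum, evalMap_tmul_basis]

variable {i u t₀} {π : N → Gal(L/k)} {θ : Gal(L/k) →* MulAut T}
  (hθ : ∀ g n t, θ g (ψ n t) = ψ n (θ g t)) (ht₀ : ∀ n, ψ n (θ (π n) t₀) = t₀)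
  (hu : ∀ n l, u n * i l = i (π n l) * u n)

include ht₀ hu

lemma evalMap_mul_galoisAction (l : L) (p : T × N) (y : L ⊗[k] SemidirectHopf k ψ) :
    evalMap ψ i u t₀ ((l ⊗ₜ basis k ψ p) * (galoisAction θ hθ).act (π p.2) y) =
      evalMap ψ i u t₀ (l ⊗ₜ basis k ψ p) * evalMap ψ i u t₀ y := by
  classical
  induction y using induction_tmul_basis with
  | zero => simp
  | add x y hx hy => simp only [map_add, mul_add, hx, hy]
  | tmul c q =>
    rw [galoisAction_tmul_basis, Algebra.TensorProduct.tmul_mul_tmul, basis_mul_basis]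
    have eq_iff : t₀ = ψ p.2 (θ (π p.2) q.1) ↔ q.1 = t₀ :=
      ⟨fun h => (θ (π p.2)).injective ((ψ p.2).injective (h.symm.trans (ht₀ p.2).symm)),
        fun h => h ▸ (ht₀ p.2).symm⟩
    have mul_eq : i l * i (π p.2 c) * (u p.2 * u q.2) = i l * u p.2 * (i c * u q.2) := by
      simp only [mul_assoc, ← mul_assoc (u p.2) (i c), hu]
    by_cases hp : p.1 = t₀
    · simp only [hp, eq_iff]
      split_ifs with hq <;> simp [evalMap_tmul_basis, hp, hq, mul_eq]
    · split_ifs <;> simp [evalMap_tmul_basis, hp]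

lemma evalMap_mul (x : L ⊗[k] SemidirectHopf k ψ) {y : L ⊗[k] SemidirectHopf k ψ}
    (hy : y ∈ (galoisAction θ hθ).fixed) :
    evalMap ψ i u t₀ (x * y) = evalMap ψ i u t₀ x * evalMap ψ i u t₀ y := by
  induction x using induction_tmul_basis with
  | zero => simp
  | add a b ha hb => simp only [map_add, add_mul, ha, hb]
  | tmul l p =>
    rw [← evalMap_mul_galoisAction hθ ht₀ hu, (galoisAction θ hθ).act_of_mem hy]

/-- The evaluation at `t₀` as an algebra homomorphism on the form. -/
def evalHom : (galoisAction θ hθ).fixed →ₐ[k] A :=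
  AlgHom.ofLinearMap (evalMap ψ i u t₀ ∘ₗ (galoisAction θ hθ).fixed.val.toLinearMap)
    (evalMap_one i u t₀) fun x y => evalMap_mul hθ ht₀ hu x.1 y.2

lemma evalHom_trace [FiniteDimensional k L] (free : ∀ g, θ g t₀ = t₀ → g = 1) (l : L) (n : N) :
    evalHom hθ ht₀ hu ((galoisAction θ hθ).trace (l ⊗ₜ basis k ψ (t₀, n))) = i l * u n := by
  classical
  change evalMap ψ i u t₀ ((galoisAction θ hθ).trace (l ⊗ₜ basis k ψ (t₀, n))) = i l * u n
  rw [GaloisHopfAction.coe_trace, map_sum, Fintype.sum_eq_single 1 fun g hg => ?_]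
  · simp [evalMap_tmul_basis]
  · rw [galoisAction_tmul_basis, evalMap_tmul_basis, if_neg (mt (free g) hg)]

end Eval

end SemidirectHopf

/-! ### The right action on `ℤ₂G` -/

section RightMul

variable {G : Type*} [Group G]

/-- The action of `G` on `ℤ₂G` that sends a basis vector `h` to `h g⁻¹`. -/
def rightMul : G →* MulAut (Z2Group G) where
  toFun g :=
    { toFun t := Multiplicative.ofAdd fun h => Multiplicative.toAdd t (h * g)
      invFun t := Multiplicative.ofAdd fun h => Multiplicative.toAdd t (h * g⁻¹)
      left_inv t := by simp; rfl
      right_inv t := by simp; rfl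
      map_mul' s t := rfl }
  map_one' := by ext t; simp; rfl
  map_mul' g g' := MulEquiv.ext fun t => congrArg Multiplicative.ofAdd (funext fun h =>
    congrArg (Multiplicative.toAdd t) (mul_assoc h g g').symm)

lemma rightMul_leftMul (g h : G) (t : Z2Group G) :
    rightMul g (leftMul h t) = leftMul h (rightMul g t) :=
  congrArg Multiplicative.ofAdd (funext fun j =>
    congrArg (Multiplicative.toAdd t) (mul_assoc h⁻¹ j g).symm)

variable (G) in
open Classical in
/-- The basis vector `1` of `ℤ₂G`. -/
def deltaOne : Z2Group G := Multiplicative.ofAdd (Pi.single 1 1)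

lemma leftMul_rightMul_deltaOne (g : G) : leftMul g (rightMul g (deltaOne G)) = deltaOne G := by
  classical
  refine congrArg Multiplicative.ofAdd (funext fun h => ?_)
  change (Pi.single 1 1 : G → ZMod 2) (g⁻¹ * h * g) = (Pi.single 1 1 : G → ZMod 2) h
  have conj_eq_one_iff : g⁻¹ * h * g = 1 ↔ h = 1 := by
    rw [mul_eq_one_iff_eq_inv, mul_eq_left]
  simp [Pi.single_apply, conj_eq_one_iff]

lemma eq_one_of_rightMul_deltaOne (g : G) (h : rightMul g (deltaOne G) = deltaOne G) : g = 1 := by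
  classical
  have apply_one : (Pi.single 1 1 : G → ZMod 2) (1 * g) = (Pi.single 1 1 : G → ZMod 2) 1 :=
    congrFun (congrArg Multiplicative.toAdd h) 1
  by_contra hg
  simp [hg] at apply_one

end RightMul

/-! ### The form of `k[T] ⋊ kĜ` -/

section SplitForm

open SemidirectHopf CrossedProduct

variable {k L : Type*} [Field k] [Field L] [Algebra k L]
  (α : Gal(L/k) × Gal(L/k) → Lˣ) (hα : groupCohomology.IsMulCocycle₂ α) [FiniteDimensional k L]

/-- The semilinear action of `Gal(L/k)` on `L ⊗[k] (k[T] ⋊ kĜ)` through right multiplication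
on `T = ℤ₂G`. -/
def splitAction : GaloisHopfAction k L (L ⊗[k] SplitHopf α hα) :=
  galoisAction rightMul fun g n t => rightMul_leftMul g (proj α hα n) t

/-- The homomorphism from the form of `k[T] ⋊ kĜ` to the crossed product algebra, given by
evaluation at the basis vector `1` of `ℤ₂G`. -/
def toCrossedProduct : (splitAction α hα).fixed →ₐ[k] CrossedProduct α hα :=
  evalHom (i := embed hα) (u := (Units.coeHom _).comp (Ghat α hα).subtype) _
    (fun n => leftMul_rightMul_deltaOne (proj α hα n)) coe_mul_embed

lemma toCrossedProduct_trace (x : L) (n : Ghat α hα) :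
    toCrossedProduct α hα ((splitAction α hα).trace (x ⊗ₜ basis k _ (deltaOne Gal(L/k), n))) =
      embed hα x * ((n : (CrossedProduct α hα)ˣ) : CrossedProduct α hα) :=
  evalHom_trace _ _ coe_mul_embed eq_one_of_rightMul_deltaOne x n

lemma toCrossedProduct_surjective : Function.Surjective (toCrossedProduct α hα) := fun z => by
  change z ∈ (toCrossedProduct α hα).range
  induction z using induction_single with
  | zero => exact zero_mem _
  | add a b ha hb => exact add_mem ha hb
  | single g x =>
    let n : Ghat α hα := ⟨unitSingle hα g 1, Subgroup.subset_closure ⟨g, rfl⟩⟩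
    exact ⟨_, (toCrossedProduct_trace α hα x n).trans
      ((embed_mul_single x 1 g).trans (by rw [mul_one]))⟩

end SplitForm

end HopfSchur

end

theorem mainTheorem3 {k : Type u} {L : Type v} [Field k] [Field L] [Algebra k L]
    [FiniteDimensional k L] [IsGalois k L]
    (α : Gal(L/k) × Gal(L/k) → Lˣ) (hα : groupCohomology.IsMulCocycle₂ α)
    (hfin : ∀ g h : Gal(L/k), IsOfFinOrder (α (g, h))) :
    ∃ (H : Type (max u v)) (_ : Ring H) (_ : HopfAlgebra k H),
      FiniteDimensional k H ∧
      Nonempty ((L ⊗[k] H) ≃ₐc[L] (L ⊗[k] HopfSchur.SplitHopf α hα)) ∧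
      (∃ f : H →ₐ[k] HopfSchur.CrossedProduct α hα, Function.Surjective f) ∧
      (¬ ringChar k ∣ Nat.card Gal(L/k) → IsSemisimpleRing H) := by
  have := HopfSchur.CrossedProduct.finite_Ghat (hα := hα) hfin
  have : Module.Finite k (HopfSchur.SplitHopf α hα) :=
    Module.Finite.of_basis (HopfSchur.SemidirectHopf.basis k _)
  let action := HopfSchur.splitAction α hα
  exact ⟨action.fixed, inferInstance, action.isHopfForm_fixed.toHopfAlgebra,
    FiniteDimensional.finiteDimensional_submodule (Subalgebra.toSubmodule action.fixed),
    ⟨action.isHopfForm_fixed.baseChangeEquiv⟩,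
    ⟨HopfSchur.toCrossedProduct α hα, HopfSchur.toCrossedProduct_surjective α hα⟩,
    fun hG => HopfSchur.SemidirectHopf.isSemisimpleRing_fixed_galoisAction _ _
      (HopfSchur.CrossedProduct.natCast_card_Ghat_ne_zero hG).isUnit⟩
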